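/- Let $r_0>0$. Let $A:\mathbb R^2\to\mathbb R^2$ be a smooth magnetic potential, let $b=\partial_1A_2-\partial_2A_1$ and $B=\begin{pmatrix}0&b\\-b&0\end{pmatrix}$ be its magnetic field, and assume the gauge condition $A(x)=-\int_0^1 sB(sx)x\,ds$. Let $V:\mathbb R^2\to\mathbb R$ be an electric potential. Assume that $V$ and $b$ are radial and compactly supported, with supports in the open ball $B(0,R)$, $R>0$, that $V$ is piecewise continuous and that $b$ is smooth. Put $\gamma(r)=\int_0^r b(\tau)\tau\,d\tau$ (so that $\gamma(R)$ is the flux of $B$ divided by $2\pi$), $\nu_R=\nu-\gamma(R)$ and $$q_\nu(r)=-\frac{2\nu(\gamma(r)-\gamma(R))}{r^2}+\frac{\gamma(r)^2-\gamma(R)^2}{r^2}+V(r).$$ For $\nu\in\mathbb C$ let $F^{\pm}(\cdot,\nu)$ be the Jost solutions, that is, the solutions on $[r_0,\infty)$ of $$-u''+\Big(\frac{\nu_R^2-\frac14}{r^2}+q_\nu(r)\Big)u=u,\qquad F^\pm(r,\nu)\sim e^{\pm ir}\quad (r\to+\infty)$$ (a solution is $C^1$ and satisfies the equation at all but finitely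 many points). Let $\alpha(\nu)=iF^-(r_0,\nu)$ and $\beta(\nu)=-iF^+(r_0,\nu)$ be the Jost functions and $\sigma(\nu)=e^{i\pi(\nu+1/2)}\alpha(\nu)/\beta(\nu)$ the Regge interpolation function. Then: 1. the Jost solutions exist and are unique for all $\nu\in\mathbb C$, and $\beta(\nu)\neq0$ and $|\sigma(\nu)|=1$ for all real $\nu$; 2. $\sigma(\nu)\to e^{i\pi\gamma(R)}$ as $\nu\to+\infty$ along the reals; 3. consequently the eigenvalues $e^{2i\delta_l}=\sigma(l)$, $l\in\mathbb Z$, of the scattering matrix accumulate at $e^{\pm i\pi\gamma(R)}$: for all real phase shifts $\delta_l$ with $e^{2i\delta_l}=\sigma(l)$ one has $e^{2i\delta_l}\to e^{i\pi\gamma(R)}$ as $l\to+\infty$ and $e^{2i\delta_l}\to e^{-i\pi\gamma(R)}$ as $l\to-\infty$. -/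

import Mathlib

open Filter Topology

noncomputable section

namespace MagneticScattering

/-- The Euclidean plane. -/
abbrev Plane : Type := EuclideanSpace ℝ (Fin 2)

/-- The magnetic field `B = dA` as an antisymmetric matrix, `B j k = ∂ⱼ Aₖ - ∂ₖ Aⱼ`. -/
def magneticMatrix (A : Plane → Plane) (x : Plane) : Matrix (Fin 2) (Fin 2) ℝ :=
  Matrix.of fun j k =>
    fderiv ℝ (fun y => A y k) x (EuclideanSpace.single j 1) -
      fderiv ℝ (fun y => A y j) x (EuclideanSpace.single k 1)

/-- The scalar magnetic field `b = ∂₁ A₂ - ∂₂ A₁`. -/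
def magneticField (A : Plane → Plane) (x : Plane) : ℝ :=
  magneticMatrix A x 0 1

/-- The transversal gauge: `A` is smooth and `A(x) = - ∫₀¹ s B(s x) x ds`. -/
structure InTransversalGauge (A : Plane → Plane) : Prop where
  smooth : ContDiff ℝ (⊤ : ℕ∞) A
  gauge : ∀ x : Plane,
    A x = - ∫ s in (0 : ℝ)..1,
      s • (WithLp.toLp 2 ((magneticMatrix A (s • x)).mulVec x.ofLp) : Plane)

/-- A function on the plane is radial. -/
def IsRadial (f : Plane → ℝ) : Prop :=
  ∀ x y : Plane, ‖x‖ = ‖y‖ → f x = f y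

/-- The profile `r ↦ f(r, 0)` of a function on the plane (used for radial functions). -/
def radialProfile (f : Plane → ℝ) (r : ℝ) : ℝ :=
  f !₂[r, 0]

/-- Piecewise continuity on `[0, ∞)`: continuity off a finite set, and finite one-sided limits at
the exceptional points. -/
def PiecewiseContinuousOnHalfLine (f : ℝ → ℝ) : Prop :=
  ∃ D : Set ℝ, D.Finite ∧
    (∀ r, 0 ≤ r → r ∉ D → ContinuousWithinAt f (Set.Ici 0) r) ∧
    (∀ r ∈ D, 0 ≤ r → ∃ a, Tendsto f (𝓝[>] r) (𝓝 a)) ∧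
    (∀ r ∈ D, 0 < r → ∃ a, Tendsto f (𝓝[<] r) (𝓝 a))

/-- The class of admissible electric potentials `V` and magnetic potentials `A`, with magnetic
field `B = dA`. -/
structure Admissible (V : Plane → ℝ) (A : Plane → Plane) : Prop where
  gauge : InTransversalGauge A
  radial_V : IsRadial V
  radial_B : IsRadial (magneticField A)
  compact_V : HasCompactSupport V
  compact_B : HasCompactSupport (magneticField A)
  piecewise_V : PiecewiseContinuousOnHalfLine (radialProfile V)
  smooth_B : ContDiff ℝ (⊤ : ℕ∞) (magneticField A)

/-- `γ(r) = ∫₀^r b(τ) τ dτ`, where `b(τ)` is the value of the radial field `b` on `|x| = τ`. -/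
def magneticGamma (A : Plane → Plane) (r : ℝ) : ℝ :=
  ∫ τ in (0 : ℝ)..r, radialProfile (magneticField A) τ * τ

/-- `q_ν(r) = - 2 ν (γ(r) - γ(R)) / r² + (γ(r)² - γ(R)²) / r² + V(r)`. -/
def qPotential (V : Plane → ℝ) (A : Plane → Plane) (R : ℝ) (ν : ℂ) (r : ℝ) : ℂ :=
  - (2 * ν * ((magneticGamma A r : ℂ) - (magneticGamma A R : ℂ))) / (r : ℂ) ^ 2 +
    ((magneticGamma A r : ℂ) ^ 2 - (magneticGamma A R : ℂ) ^ 2) / (r : ℂ) ^ 2 +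
    (radialProfile V r : ℂ)

/-- `u` solves `-u'' + ((ν_R² - 1/4) / r² + q_ν(r)) u = u` on `[r₀, ∞)`, with `ν_R = ν - γ(R)`.
As `V` is only piecewise continuous, a solution is a `C¹` function on `[r₀, ∞)` satisfying the
equation at all but finitely many points. -/
def IsRadialSolution (V : Plane → ℝ) (A : Plane → Plane) (r₀ R : ℝ) (ν : ℂ) (u : ℝ → ℂ) : Prop :=
  ∃ du : ℝ → ℂ,
    ContinuousOn du (Set.Ici r₀) ∧
    (∀ r, r₀ ≤ r → HasDerivWithinAt u (du r) (Set.Ici r₀) r) ∧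
    ∃ S : Set ℝ, S.Finite ∧ ∀ r, r₀ < r → r ∉ S → ∃ ddu : ℂ, HasDerivAt du ddu r ∧
      - ddu + (((ν - (magneticGamma A R : ℂ)) ^ 2 - 1 / 4) / (r : ℂ) ^ 2 +
        qPotential V A R ν r) * u r = u r

/-- A Jost solution: a solution of the radial equation with `u(r) ∼ e^{κ r}` as `r → +∞`, where
`κ = i` for `F⁺` and `κ = -i` for `F⁻`. -/
def IsJostSolution (V : Plane → ℝ) (A : Plane → Plane) (r₀ R : ℝ) (ν κ : ℂ) (u : ℝ → ℂ) : Prop :=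
  IsRadialSolution V A r₀ R ν u ∧
    Asymptotics.IsEquivalent atTop u (fun r : ℝ => Complex.exp (κ * (r : ℂ)))

open Classical in
/-- The Jost solution with `u(r) ∼ e^{κ r}` (zero if there is none); it is determined on
`[r₀, ∞)`, and its values for `r < r₀` are irrelevant. -/
def jostSolution (V : Plane → ℝ) (A : Plane → Plane) (r₀ R : ℝ) (ν κ : ℂ) : ℝ → ℂ :=
  if h : ∃ u, IsJostSolution V A r₀ R ν κ u then h.choose else 0

/-- `F⁺(r, ν)`. -/
def jostPlus (V : Plane → ℝ) (A : Plane → Plane) (r₀ R : ℝ) (r : ℝ) (ν : ℂ) : ℂ :=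
  jostSolution V A r₀ R ν Complex.I r

/-- `F⁻(r, ν)`. -/
def jostMinus (V : Plane → ℝ) (A : Plane → Plane) (r₀ R : ℝ) (r : ℝ) (ν : ℂ) : ℂ :=
  jostSolution V A r₀ R ν (-Complex.I) r

/-- The regular solution `Φ(r, ν) = i (F⁻(r₀, ν) F⁺(r, ν) - F⁺(r₀, ν) F⁻(r, ν))`. -/
def regularSolution (V : Plane → ℝ) (A : Plane → Plane) (r₀ R : ℝ) (r : ℝ) (ν : ℂ) : ℂ :=
  Complex.I * (jostMinus V A r₀ R r₀ ν * jostPlus V A r₀ R r ν -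
    jostPlus V A r₀ R r₀ ν * jostMinus V A r₀ R r ν)

/-- The Jost function `α(ν) = i F⁻(r₀, ν)`, the coefficient of `F⁺` in `Φ`. -/
def jostAlpha (V : Plane → ℝ) (A : Plane → Plane) (r₀ R : ℝ) (ν : ℂ) : ℂ :=
  Complex.I * jostMinus V A r₀ R r₀ ν

/-- The Jost function `β(ν) = -i F⁺(r₀, ν)`, the coefficient of `F⁻` in `Φ`. -/
def jostBeta (V : Plane → ℝ) (A : Plane → Plane) (r₀ R : ℝ) (ν : ℂ) : ℂ :=
  - Complex.I * jostPlus V A r₀ R r₀ ν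

theorem regularSolution_dirichlet (V : Plane → ℝ) (A : Plane → Plane) (r₀ R : ℝ) (ν : ℂ) :
    regularSolution V A r₀ R r₀ ν = 0 := by
  unfold regularSolution; ring

theorem regularSolution_eq (V : Plane → ℝ) (A : Plane → Plane) (r₀ R r : ℝ) (ν : ℂ) :
    regularSolution V A r₀ R r ν =
      jostAlpha V A r₀ R ν * jostPlus V A r₀ R r ν +
        jostBeta V A r₀ R ν * jostMinus V A r₀ R r ν := by
  unfold regularSolution jostAlpha jostBeta; ring

/-- The Regge interpolation function `σ(ν) = e^{iπ(ν + 1/2)} α(ν) / β(ν)`. -/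
def regge (V : Plane → ℝ) (A : Plane → Plane) (r₀ R : ℝ) (ν : ℂ) : ℂ :=
  Complex.exp (Complex.I * (Real.pi : ℂ) * (ν + 1 / 2)) *
    (jostAlpha V A r₀ R ν / jostBeta V A r₀ R ν)

end MagneticScattering

end

namespace MagneticScattering

open Set MeasureTheory

/-! ### Differentiation off a finite set -/

/-! Completing the square turns the radial equation into `u'' = k u` with `k = ((ν - γ(r))² -
1/4)/r² + V - 1`. Beyond the support this is a Bessel equation `u'' = (m(m+1)/r² - 1) u` with
`m(m+1) = ν_R² - 1/4`. There the Jost solutions are explicit Laplace integrals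
(`exteriorJost_isJost`), and an initial value problem solved backwards carries them to `r₀`
(`IsSolution.exists_extension`). The Wronskian of two solutions is constant and can be computed at
infinity. This gives uniqueness (`IsJost.eqOn`) and, for real `ν`, where `F⁻` is the conjugate of
`F⁺`, excludes a zero of `F⁺` at `r₀`. Hence `β ≠ 0` and `|σ| = 1`.

For the limit take `ν` real and `m = |ν_R| - 1/2`. Everything reduces to the argument of `F⁺(r₀,
ν)`, since `F⁻/F⁺` is a conjugate quotient. Shifting the contour in the Laplace integral shows that,
for `r` beyond the support, `e^{-iπm/2} F⁺` is a positive factor times `G + E`, where `|E| ≤ 1` and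
`G = ∫ e^{-rx}(x²+1)^m dx` is real and at least of order `10^m` (`exp_mul_laplace_jostDensity`,
`exteriorJost_phase`). So the rotated solution `h` is almost real there.

This must be transported through the support. For large `|ν|` the centrifugal term makes `k ≥ 0` on
`(r₀, 2b)`, where `b = max R r₀`, so `(Re h)²` is convex. It is smaller at `2b` than at `b`, hence
it stays above its value at `b` on `[r₀, b]`. The quotient `Im h / Re h` has derivative `W/(Re h)²`
with `W` constant; its smallness at `b` and `2b` bounds `W`, and this bounds the quotient at `r₀`
(`IsSolution.abs_im_div_re_le`). No perturbation estimate on the potentials is needed.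

Consequently `(F⁻/F⁺)(r₀) e^{iπm} → 1` as `|ν| → ∞` (`eventually_jost_phase`). Inserting `m = ν -
γ(R) - 1/2` gives `σ → e^{iπγ(R)}` at `+∞`. Inserting `m = -ν + γ(R) - 1/2` gives `e^{-2πiν} σ →
e^{-iπγ(R)}` at `-∞`, and the exponential is `1` at integers. -/

theorem le_of_hasDerivAt_nonneg_off_finite {f f' : ℝ → ℝ} {S : Set ℝ} (hS : S.Finite) :
    ∀ {a b : ℝ}, a ≤ b → ContinuousOn f (Icc a b) →
      (∀ x ∈ Ioo a b, x ∉ S → HasDerivAt f (f' x) x ∧ 0 ≤ f' x) → f a ≤ f b := by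
  induction S, hS using Set.Finite.induction_on with
  | empty =>
    intro a b hab hc hd
    have hm : MonotoneOn f (Icc a b) := by
      refine monotoneOn_of_deriv_nonneg (convex_Icc a b) hc ?_ ?_
      · intro x hx
        rw [interior_Icc] at hx
        exact (hd x hx (notMem_empty x)).1.differentiableAt.differentiableWithinAt
      · intro x hx
        rw [interior_Icc] at hx
        rw [(hd x hx (notMem_empty x)).1.deriv]
        exact (hd x hx (notMem_empty x)).2
    exact hm (left_mem_Icc.2 hab) (right_mem_Icc.2 hab) hab
  | @insert s S _ _ ih =>
    intro a b hab hc hd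
    -- Only continuity is used at the new exceptional point: the interval is cut there and the two
    -- inequalities are chained.
    by_cases hs : s ∈ Ioo a b
    · refine (ih hs.1.le (hc.mono (Icc_subset_Icc_right hs.2.le)) ?_).trans
        (ih hs.2.le (hc.mono (Icc_subset_Icc_left hs.1.le)) ?_)
      · intro x hx hxS
        exact hd x ⟨hx.1, hx.2.trans hs.2⟩ (by rintro (h | h); exacts [hx.2.ne h, hxS h])
      · intro x hx hxS
        exact hd x ⟨hs.1.trans hx.1, hx.2⟩ (by rintro (h | h); exacts [hx.1.ne' h, hxS h])
    · refine ih hab hc fun x hx hxS => hd x hx ?_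
      rintro (h | h)
      exacts [hs (h ▸ hx), hxS h]

theorem eq_of_hasDerivAt_zero_off_finite {f : ℝ → ℂ} {S : Set ℝ} (hS : S.Finite) {a b : ℝ}
    (hab : a ≤ b) (hc : ContinuousOn f (Icc a b))
    (hd : ∀ x ∈ Ioo a b, x ∉ S → HasDerivAt f 0 x) : f a = f b := by
  have key : ∀ L : ℂ →L[ℝ] ℝ, L (f a) ≤ L (f b) := fun L =>
    le_of_hasDerivAt_nonneg_off_finite (f := fun x => L (f x)) (f' := fun _ => 0) hS hab
      (L.continuous.comp_continuousOn hc) fun x hx hxS =>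
        ⟨(L.hasFDerivAt.comp_hasDerivAt x (hd x hx hxS)).congr_deriv (map_zero L), le_rfl⟩
  apply Complex.ext
  · exact le_antisymm (key Complex.reCLM) (by simpa using key (-Complex.reCLM))
  · exact le_antisymm (key Complex.imCLM) (by simpa using key (-Complex.imCLM))

theorem norm_exp_mul_ofReal {κ : ℂ} (hκ : κ = Complex.I ∨ κ = -Complex.I) (r : ℝ) :
    ‖Complex.exp (κ * r)‖ = 1 := by
  rcases hκ with rfl | rfl <;> simp [Complex.norm_exp]

/-- If `v` and `v''` tend to zero at infinity, so does `v'`. -/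
theorem tendsto_deriv_zero_of_tendsto_zero {v dv ddv : ℝ → ℂ}
    (hv : ∀ᶠ r in atTop, HasDerivAt v (dv r) r) (hdv : ∀ᶠ r in atTop, HasDerivAt dv (ddv r) r)
    (h0 : Tendsto v atTop (𝓝 0)) (h2 : Tendsto ddv atTop (𝓝 0)) : Tendsto dv atTop (𝓝 0) := by
  rw [Metric.tendsto_nhds] at h0 h2 ⊢
  intro ε hε
  obtain ⟨N, hN⟩ := eventually_atTop.1
    (hv.and (hdv.and ((h0 (ε / 4) (by positivity)).and (h2 (ε / 4) (by positivity)))))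
  simp only [dist_zero_right] at hN ⊢
  filter_upwards [eventually_ge_atTop N] with r hr
  have h1 : ∀ s ∈ Icc r (r + 1), ‖dv s - dv r‖ ≤ ε / 4 := by
    intro s hs
    have := (convex_Icc r (r + 1)).norm_image_sub_le_of_norm_hasDerivWithin_le
      (f := dv) (f' := ddv) (C := ε / 4)
      (fun x hx => (hN x (hr.trans hx.1)).2.1.hasDerivWithinAt)
      (fun x hx => (hN x (hr.trans hx.1)).2.2.2.le) (left_mem_Icc.2 (by linarith)) hs
    refine this.trans ?_
    have h3 : ‖s - r‖ ≤ 1 := by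
      rw [Real.norm_of_nonneg (by linarith [hs.1])]; linarith [hs.2]
    nlinarith
  -- Since `dv` varies by at most `ε/4` on `[r, r+1]`, the increment of `v` over this unit interval
  -- is within `ε/4` of `dv r`.
  have h4 := (convex_Icc r (r + 1)).norm_image_sub_le_of_norm_hasDerivWithin_le
      (f := fun s => v s - (s : ℂ) * dv r) (f' := fun s => dv s - dv r) (C := ε / 4)
      (fun x hx => ((hN x (hr.trans hx.1)).1.sub (by
        simpa using (Complex.ofRealCLM.hasDerivAt (x := x)).mul_const (dv r))).hasDerivWithinAt)
      h1 (left_mem_Icc.2 (by linarith)) (right_mem_Icc.2 (by linarith))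
  have h5 : v (r + 1) - ((r + 1 : ℝ) : ℂ) * dv r - (v r - (r : ℂ) * dv r) =
      v (r + 1) - v r - dv r := by push_cast; ring
  have h6 : ‖(r + 1) - r‖ = 1 := by simp
  rw [h5, h6, mul_one] at h4
  have h7 := (hN r hr).2.2.1
  have h8 := (hN (r + 1) (by linarith)).2.2.1
  calc ‖dv r‖ = ‖v (r + 1) - v r - (v (r + 1) - v r - dv r)‖ := by congr 1; ring
    _ ≤ ‖v (r + 1)‖ + ‖v r‖ + ‖v (r + 1) - v r - dv r‖ :=
      (norm_sub_le _ _).trans (by gcongr; exact norm_sub_le _ _)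
    _ < ε := by linarith

/-! ### The equation `u'' = k u` -/

/-- `u` is a `C¹` function on `[a, ∞)` with derivative `du`, and `u'' = k u` off a finite set. -/
def IsSolution (k : ℝ → ℂ) (a : ℝ) (u du : ℝ → ℂ) : Prop :=
  ContinuousOn du (Ici a) ∧ (∀ r, a ≤ r → HasDerivWithinAt u (du r) (Ici a) r) ∧
    ∃ S : Set ℝ, S.Finite ∧ ∀ r, a < r → r ∉ S → HasDerivAt du (k r * u r) r

/-- A solution of `u'' = k u` on `[a, ∞)` with `u(r) ∼ e^{κ r}`. -/
def IsJost (k : ℝ → ℂ) (a : ℝ) (κ : ℂ) (u du : ℝ → ℂ) : Prop :=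
  IsSolution k a u du ∧ Tendsto (fun r : ℝ => u r - Complex.exp (κ * r)) atTop (𝓝 0)

section Solutions

variable {k : ℝ → ℂ} {a : ℝ} {κ : ℂ} {u du v dv : ℝ → ℂ}

theorem IsSolution.continuousOn (h : IsSolution k a u du) : ContinuousOn u (Ici a) :=
  fun r hr => (h.2.1 r hr).continuousWithinAt

theorem IsSolution.hasDerivAt (h : IsSolution k a u du) {r : ℝ} (hr : a < r) :
    HasDerivAt u (du r) r :=
  (h.2.1 r hr.le).hasDerivAt (Ici_mem_nhds hr)

theorem IsSolution.eventually (h : IsSolution k a u du) :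
    ∀ᶠ r in atTop, HasDerivAt u (du r) r ∧ HasDerivAt du (k r * u r) r := by
  obtain ⟨S, hS, hd⟩ := h.2.2
  obtain ⟨M, hM⟩ := hS.bddAbove
  filter_upwards [eventually_gt_atTop a, eventually_gt_atTop M] with r h1 h2
  exact ⟨h.hasDerivAt h1, hd r h1 fun hr => (hM hr).not_gt h2⟩

theorem IsSolution.wronskian_eq (hu : IsSolution k a u du) (hv : IsSolution k a v dv) {r s : ℝ}
    (hr : a ≤ r) (hs : a ≤ s) : u r * dv r - du r * v r = u s * dv s - du s * v s := by
  wlog hrs : r ≤ s generalizing r s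
  · exact (this hs hr (le_of_not_ge hrs)).symm
  obtain ⟨S, hS, hSd⟩ := hu.2.2
  obtain ⟨T, hT, hTd⟩ := hv.2.2
  have hsub : Icc r s ⊆ Ici a := fun x hx => hr.trans hx.1
  refine eq_of_hasDerivAt_zero_off_finite (f := fun r => u r * dv r - du r * v r) (hS.union hT)
    hrs ?_ fun x hx hxS => ?_
  · exact ((hu.continuousOn.mul hv.1).sub (hu.1.mul hv.continuousOn)).mono hsub
  · have hax := hr.trans_lt hx.1
    refine (((hu.hasDerivAt hax).mul (hTd x hax fun h => hxS (Or.inr h))).sub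
      ((hSd x hax fun h => hxS (Or.inl h)).mul (hv.hasDerivAt hax))).congr_deriv ?_
    ring

/-- The asymptotics of a Jost solution may be differentiated: `v = u - e^{κr}` tends to zero, and so
does `v'' = k v + (k + 1) e^{κr}`, because `κ² = -1` and `k → -1`. -/
theorem IsJost.tendsto_deriv (hk : Tendsto k atTop (𝓝 (-1))) (hκ : κ = Complex.I ∨ κ = -Complex.I)
    (h : IsJost k a κ u du) :
    Tendsto (fun r : ℝ => du r - κ * Complex.exp (κ * r)) atTop (𝓝 0) := by
  have hκ2 : κ * κ = -1 := by rcases hκ with rfl | rfl <;> simp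
  have hexp : ∀ r : ℝ, HasDerivAt (fun r : ℝ => Complex.exp (κ * r))
      (κ * Complex.exp (κ * r)) r := by
    intro r
    have h1 : HasDerivAt (fun r : ℝ => κ * (r : ℂ)) κ r := by
      simpa using (Complex.ofRealCLM.hasDerivAt (x := r)).const_mul κ
    exact h1.cexp.congr_deriv (mul_comm _ _)
  have hnorm := norm_exp_mul_ofReal hκ
  refine tendsto_deriv_zero_of_tendsto_zero
    (ddv := fun r => k r * u r - κ * (κ * Complex.exp (κ * r))) ?_ ?_ h.2 ?_
  · filter_upwards [h.1.eventually] with r hr using hr.1.sub (hexp r)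
  · filter_upwards [h.1.eventually] with r hr using hr.2.sub ((hexp r).const_mul κ)
  · have h1 : Tendsto (fun r : ℝ => k r * (u r - Complex.exp (κ * r))) atTop (𝓝 0) := by
      simpa using hk.mul h.2
    have h2 : Tendsto (fun r : ℝ => (k r + 1) * Complex.exp (κ * r)) atTop (𝓝 0) := by
      have h3 : Tendsto (fun r => k r + 1) atTop (𝓝 0) := by simpa using hk.add_const 1
      rw [tendsto_zero_iff_norm_tendsto_zero] at h3 ⊢
      simpa [hnorm] using h3
    have h3 := h1.add h2
    rw [add_zero] at h3
    refine h3.congr fun r => ?_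
    linear_combination Complex.exp (κ * r) * hκ2

/-- The Wronskian is constant and asymptotic to `(κ' - κ) e^{(κ+κ')r}`. Either `κ' = κ` and the
prefactor vanishes, or `κ' = -κ` and the exponential is `1`. -/
theorem IsJost.wronskian_eq (hk : Tendsto k atTop (𝓝 (-1))) {κ' : ℂ}
    (hκ : κ = Complex.I ∨ κ = -Complex.I) (hκ' : κ' = Complex.I ∨ κ' = -Complex.I)
    (hu : IsJost k a κ u du) (hv : IsJost k a κ' v dv) {r : ℝ} (hr : a ≤ r) :
    u r * dv r - du r * v r = κ' - κ := by
  have hb : ∀ {κ : ℂ}, (κ = Complex.I ∨ κ = -Complex.I) → ∀ {f : ℝ → ℂ},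
      Tendsto f atTop (𝓝 0) → Tendsto (fun r : ℝ => f r * Complex.exp (κ * r)) atTop (𝓝 0) := by
    intro κ hκ f hf
    rw [tendsto_zero_iff_norm_tendsto_zero] at hf ⊢
    simpa [norm_exp_mul_ofReal hκ] using hf
  have hdu := hu.tendsto_deriv hk hκ
  have hdv := hv.tendsto_deriv hk hκ'
  have hlim : Tendsto (fun r : ℝ => u r * dv r - du r * v r -
      (κ' - κ) * Complex.exp ((κ + κ') * r)) atTop (𝓝 0) := by
    have h1 := (hu.2.mul hdv).add
      (((hb hκ' hu.2).const_mul κ').add (hb hκ hdv))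
    have h2 := (hdu.mul hv.2).add
      ((hb hκ' hdu).add ((hb hκ hv.2).const_mul κ))
    have h3 := h1.sub h2
    simp only [mul_zero, add_zero, sub_zero] at h3
    refine h3.congr fun r => ?_
    rw [add_mul, Complex.exp_add]
    ring
  have hmul : ∀ r : ℝ, (κ' - κ) * Complex.exp ((κ + κ') * r) = κ' - κ := by
    intro r
    rcases hκ with rfl | rfl <;> rcases hκ' with rfl | rfl <;> simp
  simp only [hmul] at hlim
  have hconst : Tendsto (fun _ : ℝ => u r * dv r - du r * v r - (κ' - κ)) atTop (𝓝 0) := by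
    refine hlim.congr' ?_
    filter_upwards [eventually_ge_atTop a] with s hs
    rw [hu.1.wronskian_eq hv.1 hs hr]
  exact sub_eq_zero.1 (tendsto_nhds_unique tendsto_const_nhds hconst)

theorem IsJost.eqOn (hk : Tendsto k atTop (𝓝 (-1))) (hκ : κ = Complex.I ∨ κ = -Complex.I)
    {u₁ du₁ u₂ du₂ : ℝ → ℂ} (h₁ : IsJost k a κ u₁ du₁) (h₂ : IsJost k a κ u₂ du₂)
    (hv : IsJost k a (-κ) v dv) : EqOn u₁ u₂ (Ici a) := by
  intro r hr
  have hκ' : -κ = Complex.I ∨ -κ = -Complex.I := by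
    rcases hκ with rfl | rfl <;> simp
  have hne : κ ≠ 0 := by rcases hκ with rfl | rfl <;> simp
  have e1 := h₁.wronskian_eq hk hκ hκ h₂ hr
  have e2 := h₁.wronskian_eq hk hκ hκ' hv hr
  have e3 := h₂.wronskian_eq hk hκ hκ' hv hr
  have : (u₁ r - u₂ r) * (-2 * κ) = 0 := by
    -- The cyclic identity between the three Wronskians of `u₁`, `u₂`, `v` eliminates all
    -- derivatives.
    linear_combination u₂ r * e2 - u₁ r * e3 - v r * e1
  have h2 : (-2 * κ) ≠ 0 := mul_ne_zero (by norm_num) hne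
  exact sub_eq_zero.1 ((mul_eq_zero.1 this).resolve_right h2)

end Solutions

/-! ### Linear Volterra equations -/

theorem integral_exp_mul_sub_le {l r b : ℝ} (hl : 0 < l) :
    ∫ s in r..b, Real.exp (l * (b - s)) ≤ Real.exp (l * (b - r)) / l := by
  have h : ∀ s ∈ uIcc r b,
      HasDerivAt (fun s => -(Real.exp (l * (b - s)) / l)) (Real.exp (l * (b - s))) s := by
    intro s _
    have h1 : HasDerivAt (fun s => l * (b - s)) (l * (0 - 1)) s :=
      ((hasDerivAt_const s b).sub (hasDerivAt_id s)).const_mul l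
    refine (h1.exp.div_const l).neg.congr_deriv ?_
    field_simp
    ring
  rw [intervalIntegral.integral_eq_sub_of_hasDerivAt h (Continuous.intervalIntegrable (by fun_prop) _ _)]
  have : 0 < 1 / l := by positivity
  simp
  positivity

/-- A Volterra equation with Lipschitz right-hand side is solvable on `[a, b]`, backwards from
`b`. -/
theorem exists_volterra_solution {E : Type*} [NormedAddCommGroup E] [NormedSpace ℝ E]
    [CompleteSpace E] {a b K : ℝ} (hab : a ≤ b) (hK : 0 ≤ K) (F : ℝ → E → E)
    (hF : ∀ s ∈ Icc a b, ∀ x y, ‖F s x - F s y‖ ≤ K * ‖x - y‖)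
    (hint : ∀ Y : ℝ → E, Continuous Y → IntervalIntegrable (fun s => F s (Y s)) volume a b)
    (Y₀ : E) :
    ∃ Y : ℝ → E, Continuous Y ∧ ∀ r ∈ Icc a b, Y r = Y₀ + ∫ s in b..r, F s (Y s) := by
  -- Writing `Y(s) = e^{l(b-s)} v(s)` amounts to using a weighted sup norm, for which the integral
  -- operator has Lipschitz constant `K/l ≤ 1/2` whatever the length of the interval.
  set l : ℝ := 2 * (K + 1) with hl
  have hl0 : 0 < l := by positivity
  let w : C(Icc a b, E) → ℝ → E := fun v s => Real.exp (l * (b - s)) • IccExtend hab v s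
  have hw : ∀ v, Continuous (w v) := fun v => by
    have : Continuous (IccExtend hab v) := v.continuous.Icc_extend'
    exact Continuous.smul (by fun_prop) this
  have hsub : ∀ {r}, r ∈ Icc a b → ∀ v, IntervalIntegrable (fun s => F s (w v s)) volume r b :=
    fun {r} hr v => (hint _ (hw v)).mono_set (by
      rw [uIcc_of_le hr.2, uIcc_of_le hab]; exact Icc_subset_Icc_left hr.1)
  have hTc : ∀ v, Continuous fun r : Icc a b => Real.exp (-(l * (b - r))) •
      (Y₀ + ∫ s in b..r, F s (w v s)) := fun v => by
    have h1 : ContinuousOn (fun r => ∫ s in b..r, F s (w v s)) (Icc a b) := by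
      have := intervalIntegral.continuousOn_primitive_interval' (hint _ (hw v)) (right_mem_uIcc)
      rwa [uIcc_of_le hab] at this
    have h2 : Continuous fun r : Icc a b => ∫ s in b..(r : ℝ), F s (w v s) :=
      continuousOn_iff_continuous_domRestrict.1 h1
    exact Continuous.smul (by fun_prop) (continuous_const.add h2)
  let T : C(Icc a b, E) → C(Icc a b, E) := fun v => ⟨_, hTc v⟩
  have hT : ContractingWith (1 / 2) T := by
    refine ⟨by norm_num, LipschitzWith.of_dist_le_mul fun v v' => ?_⟩
    rw [ContinuousMap.dist_le (by positivity)]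
    intro r
    have hr := r.2
    have e1 : T v r - T v' r = Real.exp (-(l * (b - r))) •
        ∫ s in b..r, (F s (w v s) - F s (w v' s)) := by
      rw [intervalIntegral.integral_sub (hsub hr v).symm (hsub hr v').symm]
      simp only [T, ContinuousMap.coe_mk, smul_sub, smul_add]
      abel
    have e2 : ‖∫ s in b..(r : ℝ), (F s (w v s) - F s (w v' s))‖ ≤
        K * dist v v' * (Real.exp (l * (b - r)) / l) := by
      rw [intervalIntegral.integral_symm, norm_neg]
      refine (intervalIntegral.norm_integral_le_of_norm_le hr.2 (g := fun s => K * dist v v' *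
        Real.exp (l * (b - s))) (ae_of_all _ fun s hs => ?_)
        (Continuous.intervalIntegrable (by fun_prop) _ _)).trans ?_
      · have hs' : s ∈ Icc a b := ⟨hr.1.trans hs.1.le, hs.2⟩
        refine (hF s hs' _ _).trans ?_
        rw [mul_assoc]
        refine mul_le_mul_of_nonneg_left ?_ hK
        simp only [w]
        rw [← smul_sub, norm_smul, Real.norm_of_nonneg (Real.exp_pos _).le, mul_comm]
        refine mul_le_mul_of_nonneg_right ?_ (Real.exp_pos _).le
        rw [IccExtend_of_mem hab _ hs', IccExtend_of_mem hab _ hs', ← dist_eq_norm]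
        exact ContinuousMap.dist_apply_le_dist _
      · rw [intervalIntegral.integral_const_mul]
        exact mul_le_mul_of_nonneg_left (integral_exp_mul_sub_le hl0) (by positivity)
    rw [dist_eq_norm, e1, norm_smul, Real.norm_of_nonneg (Real.exp_pos _).le]
    refine (mul_le_mul_of_nonneg_left e2 (Real.exp_pos _).le).trans ?_
    have e3 : Real.exp (-(l * (b - r))) * (K * dist v v' * (Real.exp (l * (b - r)) / l)) =
        K / l * dist v v' := by
      rw [Real.exp_neg]
      field_simp
    rw [e3]
    refine mul_le_mul_of_nonneg_right ?_ dist_nonneg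
    rw [div_le_iff₀ hl0]
    push_cast
    linarith
  obtain ⟨v, hv⟩ : ∃ v, T v = v := ⟨_, hT.fixedPoint_isFixedPt⟩
  refine ⟨w v, hw v, fun r hr => ?_⟩
  have h1 : w v r = Real.exp (l * (b - r)) • T v ⟨r, hr⟩ := by
    rw [hv]; simp only [w, IccExtend_of_mem hab _ hr]
  rw [h1]
  simp only [T, ContinuousMap.coe_mk]
  rw [smul_smul, ← Real.exp_add]
  simp

/-- The initial value problem for `u'' = k u` on `[a, b]`, with data at `b` and `k` bounded and
continuous off a finite set. -/
theorem exists_interval_solution {a b K : ℝ} (hab : a ≤ b) {k : ℝ → ℂ} {D : Set ℝ}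
    (hD : D.Finite) (hk : ∀ r ∈ Icc a b, r ∉ D → ContinuousAt k r)
    (hK : ∀ r ∈ Icc a b, ‖k r‖ ≤ K) (c d : ℂ) :
    ∃ u du : ℝ → ℂ, u b = c ∧ du b = d ∧ ContinuousOn du (Icc a b) ∧
      (∀ r ∈ Icc a b, HasDerivWithinAt u (du r) (Icc a b) r) ∧
      ∀ r ∈ Ioo a b, r ∉ D → HasDerivAt du (k r * u r) r := by
  have hK0 : 0 ≤ K := (norm_nonneg _).trans (hK a (left_mem_Icc.2 hab))
  have hkm : AEStronglyMeasurable k (volume.restrict (uIoc a b)) := by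
    have h1 : AEStronglyMeasurable k (volume.restrict (Icc a b \ D)) :=
      ContinuousOn.aestronglyMeasurable
        (fun r hr => (hk r hr.1 hr.2).continuousWithinAt)
        (measurableSet_Icc.diff hD.measurableSet)
    have h2 : volume.restrict (Icc a b \ D) = volume.restrict (Icc a b) :=
      Measure.restrict_congr_set (sdiff_null_ae_eq_self (hD.measure_zero _))
    rw [h2] at h1
    rw [uIoc_of_le hab]
    exact h1.mono_measure (Measure.restrict_mono Ioc_subset_Icc_self le_rfl)
  have hki : ∀ f : ℝ → ℂ, Continuous f → IntervalIntegrable (fun s => k s * f s) volume a b := by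
    intro f hf
    refine IntervalIntegrable.mono_fun' (g := fun s => K * ‖f s‖)
      (Continuous.intervalIntegrable (by fun_prop) _ _)
      (hkm.mul hf.aestronglyMeasurable) ?_
    refine (ae_restrict_iff' measurableSet_uIoc).2 (ae_of_all _ fun s hs => ?_)
    rw [uIoc_of_le hab] at hs
    simp only [norm_mul]
    exact mul_le_mul_of_nonneg_right (hK s (Ioc_subset_Icc_self hs)) (norm_nonneg _)
  have hFi : ∀ Y : ℝ → ℂ × ℂ, Continuous Y →
      IntervalIntegrable (fun s => ((Y s).2, k s * (Y s).1)) volume a b := by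
    intro Y hY
    have h1 : IntervalIntegrable (fun s => (Y s).2) volume a b :=
      Continuous.intervalIntegrable (by fun_prop) _ _
    have h2 := hki (fun s => (Y s).1) (by fun_prop)
    exact ⟨h1.1.prodMk h2.1, h1.2.prodMk h2.2⟩
  -- First order system for `(u, u')`; in the maximum norm its Lipschitz constant is at most `max 1
  -- K ≤ K + 1`.
  obtain ⟨Y, hYc, hY⟩ := exists_volterra_solution hab (K := K + 1) (by positivity)
    (fun s y => (y.2, k s * y.1)) (fun s hs x y => by
      rw [Prod.mk_sub_mk, ← mul_sub]
      refine norm_prod_le_iff.2 ⟨?_, ?_⟩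
      · refine (norm_snd_le (x - y)).trans ?_
        nlinarith [norm_nonneg (x - y)]
      · simp only [norm_mul]
        have := norm_fst_le (x - y)
        exact mul_le_mul ((hK s hs).trans (by linarith)) this (norm_nonneg _) (by positivity))
    hFi (c, d)
  have hfst : ∀ r ∈ Icc a b, (Y r).1 = c + ∫ s in b..r, (Y s).2 := by
    intro r hr
    have h := hY r hr
    have h2 := (ContinuousLinearMap.fst ℝ ℂ ℂ).intervalIntegral_comp_comm
      (μ := volume) (a := b) (b := r) (f := fun s => ((Y s).2, k s * (Y s).1))
      (((hFi Y hYc).mono_set (by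
        rw [uIcc_of_le hr.2, uIcc_of_le hab]; exact Icc_subset_Icc_left hr.1)).symm)
    rw [h, Prod.fst_add]
    simp only [ContinuousLinearMap.coe_fst'] at h2
    rw [h2]
  have hsnd : ∀ r ∈ Icc a b, (Y r).2 = d + ∫ s in b..r, k s * (Y s).1 := by
    intro r hr
    have h := hY r hr
    have h2 := (ContinuousLinearMap.snd ℝ ℂ ℂ).intervalIntegral_comp_comm
      (μ := volume) (a := b) (b := r) (f := fun s => ((Y s).2, k s * (Y s).1))
      (((hFi Y hYc).mono_set (by
        rw [uIcc_of_le hr.2, uIcc_of_le hab]; exact Icc_subset_Icc_left hr.1)).symm)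
    rw [h, Prod.snd_add]
    simp only [ContinuousLinearMap.coe_snd'] at h2
    rw [h2]
  refine ⟨fun r => (Y r).1, fun r => (Y r).2, ?_, ?_, (by fun_prop), ?_, ?_⟩
  · simpa using hfst b (right_mem_Icc.2 hab)
  · simpa using hsnd b (right_mem_Icc.2 hab)
  · intro r hr
    have h1 : HasDerivAt (fun r => c + ∫ s in b..r, (Y s).2) (Y r).2 r :=
      (intervalIntegral.integral_hasDerivAt_right (Continuous.intervalIntegrable (by fun_prop) _ _)
        (Continuous.stronglyMeasurableAtFilter (by fun_prop) _ _) (by fun_prop)).const_add c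
    exact h1.hasDerivWithinAt.congr hfst (hfst r hr)
  · intro r hr hrD
    have hr' := Ioo_subset_Icc_self hr
    have hint : IntervalIntegrable (fun s => k s * (Y s).1) volume b r :=
      ((hki (fun s => (Y s).1) (by fun_prop)).mono_set (by
        rw [uIcc_of_le hr'.2, uIcc_of_le hab]; exact Icc_subset_Icc_left hr'.1)).symm
    have hmeas : StronglyMeasurableAtFilter (fun s => k s * (Y s).1) (𝓝 r) := by
      refine ⟨uIoc a b, ?_, hkm.mul (by fun_prop)⟩
      rw [uIoc_of_le hab]
      exact mem_of_superset (Ioo_mem_nhds hr.1 hr.2) Ioo_subset_Ioc_self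
    have h1 : HasDerivAt (fun r => d + ∫ s in b..r, k s * (Y s).1) (k r * (Y r).1) r :=
      (intervalIntegral.integral_hasDerivAt_right hint hmeas ((hk r hr' hrD).mul (by fun_prop))).const_add d
    refine h1.congr_of_eventuallyEq ?_
    filter_upwards [Ioo_mem_nhds hr.1 hr.2] with s hs using hsnd s (Ioo_subset_Icc_self hs)

/-- Continuation of a solution from `[b, ∞)` to `[a, ∞)`. -/
theorem IsSolution.exists_extension {a b K : ℝ} (hab : a ≤ b) {k : ℝ → ℂ} {D : Set ℝ}
    (hD : D.Finite) (hk : ∀ r ∈ Icc a b, r ∉ D → ContinuousAt k r)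
    (hK : ∀ r ∈ Icc a b, ‖k r‖ ≤ K) {u du : ℝ → ℂ} (hu : IsSolution k b u du) :
    ∃ w dw : ℝ → ℂ, IsSolution k a w dw ∧ EqOn w u (Ici b) := by
  obtain ⟨y, dy, hy, hdy, hyc, hyd, hydd⟩ := exists_interval_solution hab hD hk hK (u b) (du b)
  obtain ⟨S, hS, hSd⟩ := hu.2.2
  set w : ℝ → ℂ := fun r => if r < b then y r else u r with hw
  set dw : ℝ → ℂ := fun r => if r < b then dy r else du r with hdw
  have w1 : ∀ r ∈ Icc a b, w r = y r := by
    intro r hr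
    rcases hr.2.lt_or_eq with h | rfl
    · simp [hw, h]
    · simp [hw, hy]
  have dw1 : ∀ r ∈ Icc a b, dw r = dy r := by
    intro r hr
    rcases hr.2.lt_or_eq with h | rfl
    · simp [hdw, h]
    · simp [hdw, hdy]
  have w2 : ∀ r ∈ Ici b, w r = u r := fun r hr => by simp [hw, (mem_Ici.1 hr).not_gt]
  have dw2 : ∀ r ∈ Ici b, dw r = du r := fun r hr => by simp [hdw, (mem_Ici.1 hr).not_gt]
  have hun : Ici a = Icc a b ∪ Ici b := (Icc_union_Ici_eq_Ici hab).symm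
  -- The junction `b` joins the exceptional set: the gluing is `C¹` there, but the one-sided second
  -- derivatives need not agree.
  refine ⟨w, dw, ⟨?_, ?_, D ∪ S ∪ {b}, (hD.union hS).union (finite_singleton b), ?_⟩, w2⟩
  · rw [hun]
    exact (hyc.congr dw1).union_of_isClosed (hu.1.congr dw2) isClosed_Icc isClosed_Ici
  · intro r hr
    rw [hun]
    rcases lt_trichotomy r b with h | rfl | h
    · have hrm : r ∈ Icc a b := ⟨hr, h.le⟩
      have h1 : HasDerivWithinAt w (dw r) (Icc a b) r := by
        rw [dw1 r hrm]; exact (hyd r hrm).congr w1 (w1 r hrm)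
      rw [← hun]
      refine h1.mono_of_mem_nhdsWithin ?_
      rw [← Ici_inter_Iic]
      exact inter_mem_nhdsWithin _ (Iic_mem_nhds h)
    · refine HasDerivWithinAt.union ?_ ?_
      · rw [dw1 r ⟨hr, le_rfl⟩]; exact (hyd r ⟨hr, le_rfl⟩).congr w1 (w1 r ⟨hr, le_rfl⟩)
      · rw [dw2 r self_mem_Ici]; exact (hu.2.1 r le_rfl).congr w2 (w2 r self_mem_Ici)
    · rw [dw2 r h.le]
      exact ((hu.hasDerivAt h).congr_of_eventuallyEq (by
        filter_upwards [Ioi_mem_nhds h] with s hs using w2 s (mem_Ioi.1 hs).le)).hasDerivWithinAt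
  · intro r hr hrS
    simp only [mem_union, mem_singleton_iff, not_or] at hrS
    rcases lt_or_gt_of_ne hrS.2 with h | h
    · rw [w1 r ⟨hr.le, h.le⟩]
      refine (hydd r ⟨hr, h⟩ hrS.1.1).congr_of_eventuallyEq ?_
      filter_upwards [Ioo_mem_nhds hr h] with s hs using dw1 s (Ioo_subset_Icc_self hs)
    · rw [w2 r h.le]
      refine (hSd r h hrS.1.2).congr_of_eventuallyEq ?_
      filter_upwards [Ioi_mem_nhds h] with s hs using dw2 s (mem_Ioi.1 hs).le

/-! ### Laplace integrals -/

/-- The Laplace integral `∫₀^∞ e^{-rt} g(t) dt`. -/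
noncomputable def laplace (g : ℝ → ℂ) (r : ℝ) : ℂ :=
  ∫ t in Ioi (0 : ℝ), (Real.exp (-(r * t)) : ℂ) * g t

/-- `g` has subexponential growth in the integrated sense. -/
def LaplaceIntegrable (g : ℝ → ℂ) : Prop :=
  ∀ r : ℝ, 0 < r → IntegrableOn (fun t => (Real.exp (-(r * t)) : ℂ) * g t) (Ioi 0)

/-- Half of the decay rate pays for the factor `t`; this makes the Laplace integrals differentiable
any number of times. -/
theorem mul_exp_neg_le {r t : ℝ} (hr : 0 < r) :
    t * Real.exp (-(r * t)) ≤ 2 / r * Real.exp (-(r / 2 * t)) := by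
  have h1 : Real.exp (-(r * t)) = Real.exp (-(r / 2 * t)) * Real.exp (-(r / 2 * t)) := by
    rw [← Real.exp_add]; ring_nf
  have h2 : r / 2 * t ≤ Real.exp (r / 2 * t) := by linarith [Real.add_one_le_exp (r / 2 * t)]
  have h3 : r / 2 * t * Real.exp (-(r / 2 * t)) ≤ 1 := by
    rw [Real.exp_neg, ← div_eq_mul_inv, div_le_one (Real.exp_pos _)]; exact h2
  have h4 : t * Real.exp (-(r / 2 * t)) ≤ 2 / r := by
    rw [le_div_iff₀ hr]; linarith
  rw [h1, ← mul_assoc]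
  exact mul_le_mul_of_nonneg_right h4 (Real.exp_pos _).le

theorem LaplaceIntegrable.mul_id {g : ℝ → ℂ} (hg : LaplaceIntegrable g) :
    LaplaceIntegrable fun t => (t : ℂ) * g t := by
  intro r hr
  refine Integrable.mono' (((hg (r / 2) (by positivity)).norm).const_mul (2 / r)) ?_ ?_
  · have h := (hg r hr).aestronglyMeasurable.mul
      (Complex.continuous_ofReal.aestronglyMeasurable (μ := volume.restrict (Ioi 0)))
    refine h.congr (ae_of_all _ fun t => ?_)
    simp only [Pi.mul_apply]
    ring
  · refine (ae_restrict_iff' measurableSet_Ioi).2 (ae_of_all _ fun t ht => ?_)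
    have ht0 : 0 < t := ht
    simp only [norm_mul, Complex.norm_real, Real.norm_of_nonneg (Real.exp_pos _).le,
      Real.norm_of_nonneg ht0.le]
    rw [← mul_assoc, ← mul_assoc, mul_comm _ t]
    exact mul_le_mul_of_nonneg_right (mul_exp_neg_le hr) (norm_nonneg _)

/-- Differentiation under the integral sign for parameters in `(r/2, ∞)`, dominated by the integrand
at rate `r/2`. -/
theorem LaplaceIntegrable.hasDerivAt {g : ℝ → ℂ} (hg : LaplaceIntegrable g) {r : ℝ}
    (hr : 0 < r) :
    HasDerivAt (laplace g) (-laplace (fun t => (t : ℂ) * g t) r) r := by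
  have h := hasDerivAt_integral_of_dominated_loc_of_deriv_le (𝕜 := ℝ)
    (μ := volume.restrict (Ioi (0 : ℝ))) (s := Ioi (r / 2))
    (F := fun r t => (Real.exp (-(r * t)) : ℂ) * g t)
    (F' := fun r t => -((Real.exp (-(r * t)) : ℂ) * ((t : ℂ) * g t)))
    (bound := fun t => ‖(Real.exp (-(r / 2 * t)) : ℂ) * ((t : ℂ) * g t)‖)
    (Ioi_mem_nhds (by linarith : r / 2 < r)) ?_ (hg r hr)
    (hg.mul_id r hr).aestronglyMeasurable.neg ?_ (hg.mul_id (r / 2) (by positivity)).norm ?_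
  · have h2 := h.2
    rw [integral_neg] at h2
    exact h2
  · filter_upwards [Ioi_mem_nhds hr] with s hs using (hg s hs).aestronglyMeasurable
  · refine (ae_restrict_iff' measurableSet_Ioi).2 (ae_of_all _ fun t ht s hs => ?_)
    have ht0 : 0 < t := ht
    rw [norm_neg, norm_mul, norm_mul _ ((t : ℂ) * g t)]
    refine mul_le_mul_of_nonneg_right ?_ (norm_nonneg _)
    simp only [Complex.norm_real, Real.norm_of_nonneg (Real.exp_pos _).le]
    exact Real.exp_le_exp.2 (by nlinarith [mem_Ioi.1 hs])
  · refine ae_of_all _ fun t s _ => ?_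
    have h1 : HasDerivAt (fun s : ℝ => -(s * t)) (-(1 * t)) s := ((hasDerivAt_id s).mul_const t).neg
    refine ((h1.exp.ofReal_comp).mul_const (g t)).congr_deriv ?_
    push_cast
    ring

/-- The common dominating function for the Laplace integrals below. One term of the exponential
series bounds `(t + 2)^N` by a multiple of `e^{r(t+2)/2}`, which leaves the decay rate `r/2`. -/
theorem integrableOn_rpow_mul_pow_mul_exp {s r : ℝ} (hs : -1 < s) (hr : 0 < r) (N : ℕ) :
    IntegrableOn (fun t : ℝ => t ^ s * (t + 2) ^ N * Real.exp (-(r * t))) (Ioi 0) := by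
  have h1 := integrableOn_rpow_mul_exp_neg_mul_rpow (p := 1) (b := r / 2) hs one_pos (by positivity)
  refine Integrable.mono' (h1.const_mul ((N.factorial : ℝ) * Real.exp r / (r / 2) ^ N)) ?_ ?_
  · refine Measurable.aestronglyMeasurable ?_
    fun_prop
  · refine (ae_restrict_iff' measurableSet_Ioi).2 (ae_of_all _ fun t ht => ?_)
    have ht0 : 0 < t := ht
    have h2 := Real.pow_div_factorial_le_exp (x := r / 2 * (t + 2)) (by positivity) N
    rw [div_le_iff₀ (by positivity), mul_pow] at h2
    have h3 : (t + 2) ^ N ≤ Real.exp (r / 2 * (t + 2)) * N.factorial / (r / 2) ^ N := by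
      rw [le_div_iff₀ (by positivity)]; linarith
    have h4 : Real.exp (r / 2 * (t + 2)) * Real.exp (-(r * t)) =
        Real.exp r * Real.exp (-(r / 2) * t) := by
      rw [← Real.exp_add, ← Real.exp_add]; ring_nf
    rw [Real.norm_of_nonneg (by positivity), Real.rpow_one]
    calc t ^ s * (t + 2) ^ N * Real.exp (-(r * t))
        ≤ t ^ s * (Real.exp (r / 2 * (t + 2)) * N.factorial / (r / 2) ^ N) *
          Real.exp (-(r * t)) := by gcongr
      _ = t ^ s * N.factorial / (r / 2) ^ N *
          (Real.exp (r / 2 * (t + 2)) * Real.exp (-(r * t))) := by ring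
      _ = _ := by rw [h4]; ring

theorem tendsto_add_two_pow_mul_exp {r : ℝ} (hr : 0 < r) (N : ℕ) (c : ℝ) :
    Tendsto (fun t : ℝ => c * ((t + 2) ^ N * Real.exp (-r * (t + 2)))) atTop (𝓝 0) := by
  have h := (Real.tendsto_pow_mul_exp_neg_atTop_nhds_zero N).comp (tendsto_id.const_mul_atTop hr)
  have h1 : Tendsto (fun t : ℝ => t ^ N * Real.exp (-r * t)) atTop (𝓝 0) := by
    have h2 := h.const_mul ((r ^ N)⁻¹)
    rw [mul_zero] at h2
    refine h2.congr fun t => ?_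
    simp only [Function.comp_apply, id, mul_pow, neg_mul]
    field_simp
  have h3 := (h1.comp (tendsto_atTop_add_const_right atTop (2 : ℝ) tendsto_id)).const_mul c
  rw [mul_zero] at h3
  exact h3

/-! ### The Jost solutions outside the support of the potentials -/

section Exterior

variable {κ m : ℂ}

theorem two_le_norm_sub (hκ : κ = Complex.I ∨ κ = -Complex.I) (x : ℝ) :
    2 ≤ ‖(x : ℂ) - 2 * κ‖ := by
  refine le_trans ?_ (Complex.abs_im_le_norm _)
  rcases hκ with rfl | rfl <;> simp

theorem sub_mem_slitPlane (hκ : κ = Complex.I ∨ κ = -Complex.I) (x : ℝ) :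
    (x : ℂ) - 2 * κ ∈ Complex.slitPlane := by
  right
  rcases hκ with rfl | rfl <;> simp

/-- As `|x - 2κ| ≥ 2`, raising the exponent from `Re m` to `⌈|Re m|⌉` only increases the modulus,
whatever the sign of `Re m`. The separate bound `t` serves the rescaled argument `x = t/r` with `r ≥
1`. -/
theorem norm_cpow_sub_le (hκ : κ = Complex.I ∨ κ = -Complex.I) (m : ℂ) {x t : ℝ} (hx : 0 ≤ x)
    (hxt : x ≤ t) :
    ‖((x : ℂ) - 2 * κ) ^ m‖ ≤ Real.exp (Real.pi * |m.im|) * (t + 2) ^ ⌈|m.re|⌉₊ := by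
  set z : ℂ := (x : ℂ) - 2 * κ with hz
  have h2 := two_le_norm_sub hκ x
  have h3 : ‖z‖ ≤ t + 2 := by
    refine (norm_sub_le _ _).trans ?_
    have : ‖κ‖ = 1 := by rcases hκ with rfl | rfl <;> simp
    simp only [Complex.norm_real, norm_mul, this, Real.norm_of_nonneg hx]
    norm_num
    linarith
  refine (Complex.norm_cpow_le z m).trans ?_
  rw [div_eq_mul_inv, ← Real.exp_neg, mul_comm]
  refine mul_le_mul (Real.exp_le_exp.2 ?_) ?_ (by positivity) (by positivity)
  · have h4 := Complex.abs_arg_le_pi z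
    calc -(z.arg * m.im) ≤ |z.arg * m.im| := neg_le_abs _
      _ = |z.arg| * |m.im| := abs_mul _ _
      _ ≤ _ := by gcongr
  · calc ‖z‖ ^ m.re ≤ ‖z‖ ^ ((⌈|m.re|⌉₊ : ℕ) : ℝ) :=
        Real.rpow_le_rpow_of_exponent_le (by linarith) ((le_abs_self _).trans (Nat.le_ceil _))
      _ = ‖z‖ ^ ⌈|m.re|⌉₊ := Real.rpow_natCast _ _
      _ ≤ _ := by gcongr

/-- The density `t^m (t - 2κ)^m`. -/
noncomputable def jostDensity (κ m : ℂ) (t : ℝ) : ℂ :=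
  (t : ℂ) ^ m * ((t : ℂ) - 2 * κ) ^ m

theorem continuous_cpow_sub (hκ : κ = Complex.I ∨ κ = -Complex.I) (m : ℂ) :
    Continuous fun t : ℝ => ((t : ℂ) - 2 * κ) ^ m :=
  Continuous.cpow (by fun_prop) continuous_const fun t => sub_mem_slitPlane hκ t

theorem continuousOn_jostDensity (hκ : κ = Complex.I ∨ κ = -Complex.I) (m : ℂ) :
    ContinuousOn (jostDensity κ m) (Ioi 0) := by
  refine ContinuousOn.mul ?_ (continuous_cpow_sub hκ m).continuousOn
  exact ContinuousOn.cpow Complex.continuous_ofReal.continuousOn continuousOn_const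
    fun t ht => Or.inl (by simpa using ht)

theorem laplaceIntegrable_jostDensity (hκ : κ = Complex.I ∨ κ = -Complex.I) (hm : -1 < m.re) :
    LaplaceIntegrable (jostDensity κ m) := by
  intro r hr
  refine Integrable.mono' ((integrableOn_rpow_mul_pow_mul_exp hm hr ⌈|m.re|⌉₊).const_mul
    (Real.exp (Real.pi * |m.im|))) ?_ ?_
  · refine ContinuousOn.aestronglyMeasurable ?_ measurableSet_Ioi
    exact ContinuousOn.mul (by fun_prop) (continuousOn_jostDensity hκ m)
  · refine (ae_restrict_iff' measurableSet_Ioi).2 (ae_of_all _ fun t ht => ?_)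
    have ht0 : 0 < t := ht
    have h := norm_cpow_sub_le hκ m ht0.le le_rfl
    simp only [jostDensity, norm_mul, Complex.norm_real, Real.norm_of_nonneg (Real.exp_pos _).le,
      Complex.norm_cpow_eq_rpow_re_of_pos ht0]
    calc Real.exp (-(r * t)) * (t ^ m.re * ‖((t : ℂ) - 2 * κ) ^ m‖)
        ≤ Real.exp (-(r * t)) * (t ^ m.re *
          (Real.exp (Real.pi * |m.im|) * (t + 2) ^ ⌈|m.re|⌉₊)) := by gcongr
      _ = _ := by ring

theorem jostDensity_add_one (hκ : κ = Complex.I ∨ κ = -Complex.I) {t : ℝ} (ht : 0 < t) :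
    jostDensity κ (m + 1) t = (t : ℂ) * ((t : ℂ) - 2 * κ) * jostDensity κ m t := by
  have h1 : (t : ℂ) ≠ 0 := by exact_mod_cast ht.ne'
  have h2 : (t : ℂ) - 2 * κ ≠ 0 := Complex.slitPlane_ne_zero (sub_mem_slitPlane hκ t)
  simp only [jostDensity, Complex.cpow_add _ _ h1, Complex.cpow_add _ _ h2, Complex.cpow_one]
  ring

theorem hasDerivAt_jostDensity_add_one (hκ : κ = Complex.I ∨ κ = -Complex.I) {t : ℝ}
    (ht : 0 < t) :
    HasDerivAt (jostDensity κ (m + 1)) ((m + 1) * (2 * t - 2 * κ) * jostDensity κ m t) t := by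
  have h1 : (t : ℂ) ≠ 0 := by exact_mod_cast ht.ne'
  have h2 : (t : ℂ) - 2 * κ ≠ 0 := Complex.slitPlane_ne_zero (sub_mem_slitPlane hκ t)
  have e1 : HasDerivAt (fun t : ℝ => (t : ℂ) ^ (m + 1)) ((m + 1) * (t : ℂ) ^ (m + 1 - 1) * 1) t :=
    ((hasDerivAt_id (t : ℂ)).cpow_const (Or.inl (by simpa using ht))).comp_ofReal
  have e2 : HasDerivAt (fun t : ℝ => ((t : ℂ) - 2 * κ) ^ (m + 1))
      ((m + 1) * ((t : ℂ) - 2 * κ) ^ (m + 1 - 1) * 1) t :=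
    (((hasDerivAt_id (t : ℂ)).sub_const (2 * κ)).cpow_const (sub_mem_slitPlane hκ t)).comp_ofReal
  refine (e1.mul e2).congr_deriv ?_
  simp only [jostDensity, add_sub_cancel_right, Complex.cpow_add _ _ h1, Complex.cpow_add _ _ h2,
    Complex.cpow_one]
  ring

theorem tendsto_exp_mul_jostDensity (hκ : κ = Complex.I ∨ κ = -Complex.I) (m : ℂ) {r : ℝ}
    (hr : 0 < r) :
    Tendsto (fun t : ℝ => (Real.exp (-(r * t)) : ℂ) * jostDensity κ m t) atTop (𝓝 0) := by
  set N := ⌈|m.re|⌉₊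
  refine squeeze_zero_norm' ?_
    (tendsto_add_two_pow_mul_exp hr (N + N) (Real.exp (Real.pi * |m.im|) * Real.exp (2 * r)))
  filter_upwards [eventually_ge_atTop (1 : ℝ)] with t ht
  have ht0 : 0 < t := by linarith
  have h := norm_cpow_sub_le hκ m ht0.le le_rfl
  have h5 : t ^ m.re ≤ (t + 2) ^ N := by
    calc t ^ m.re ≤ t ^ ((N : ℕ) : ℝ) :=
        Real.rpow_le_rpow_of_exponent_le ht ((le_abs_self _).trans (Nat.le_ceil _))
      _ = t ^ N := Real.rpow_natCast _ _
      _ ≤ _ := by gcongr; linarith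
  have h6 : Real.exp (-(r * t)) = Real.exp (2 * r) * Real.exp (-r * (t + 2)) := by
    rw [← Real.exp_add]; ring_nf
  simp only [jostDensity, norm_mul, Complex.norm_real, Real.norm_of_nonneg (Real.exp_pos _).le,
    Complex.norm_cpow_eq_rpow_re_of_pos ht0]
  calc Real.exp (-(r * t)) * (t ^ m.re * ‖((t : ℂ) - 2 * κ) ^ m‖)
      ≤ Real.exp (-(r * t)) * ((t + 2) ^ N *
        (Real.exp (Real.pi * |m.im|) * (t + 2) ^ N)) := by gcongr
    _ = _ := by rw [h6, pow_add]; ring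

/-- The second order equation for the Laplace transform of `t^m (t - 2κ)^m`. -/
theorem laplace_jostDensity_ode (hκ : κ = Complex.I ∨ κ = -Complex.I) (hm : -1 < m.re) {r : ℝ}
    (hr : 0 < r) :
    r * (laplace (fun t => (t : ℂ) * ((t : ℂ) * jostDensity κ m t)) r -
        2 * κ * laplace (fun t => (t : ℂ) * jostDensity κ m t) r) =
      (m + 1) * (2 * laplace (fun t => (t : ℂ) * jostDensity κ m t) r -
        2 * κ * laplace (jostDensity κ m) r) := by
  have hg := laplaceIntegrable_jostDensity hκ hm
  have i0 := hg r hr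
  have i1 := hg.mul_id r hr
  have i2 := hg.mul_id.mul_id r hr
  -- The identity is the integral over `(0, ∞)` of the derivative of `e^{-rt} (t^{m+1} (t -
  -- 2κ)^{m+1})`, which vanishes at both ends; at `0` this uses `Re (m + 1) > 0`.
  have hcont : ContinuousWithinAt
      (fun t : ℝ => (Real.exp (-(r * t)) : ℂ) * jostDensity κ (m + 1) t) (Ici 0) 0 := by
    refine ContinuousAt.continuousWithinAt ?_
    refine ContinuousAt.mul (by fun_prop) (ContinuousAt.mul ?_
      (continuous_cpow_sub hκ _).continuousAt)
    exact Complex.continuousAt_ofReal_cpow_const _ _ (Or.inl (by simpa using by linarith))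
  have hder : ∀ t ∈ Ioi (0 : ℝ), HasDerivAt
      (fun t : ℝ => (Real.exp (-(r * t)) : ℂ) * jostDensity κ (m + 1) t)
      (-r * ((Real.exp (-(r * t)) : ℂ) * ((t : ℂ) * ((t : ℂ) * jostDensity κ m t))) +
        (2 * κ * r + 2 * (m + 1)) * ((Real.exp (-(r * t)) : ℂ) * ((t : ℂ) * jostDensity κ m t)) +
        (-(2 * κ * (m + 1))) * ((Real.exp (-(r * t)) : ℂ) * jostDensity κ m t)) t := by
    intro t ht
    have h1 : HasDerivAt (fun t : ℝ => -(r * t)) (-(r * 1)) t :=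
      ((hasDerivAt_id t).const_mul r).neg
    refine (h1.exp.ofReal_comp.mul (hasDerivAt_jostDensity_add_one (m := m) hκ ht)).congr_deriv ?_
    rw [jostDensity_add_one hκ ht]
    push_cast
    ring
  have hint : IntegrableOn (fun t : ℝ =>
      -r * ((Real.exp (-(r * t)) : ℂ) * ((t : ℂ) * ((t : ℂ) * jostDensity κ m t))) +
        (2 * κ * r + 2 * (m + 1)) * ((Real.exp (-(r * t)) : ℂ) * ((t : ℂ) * jostDensity κ m t)) +
        (-(2 * κ * (m + 1))) * ((Real.exp (-(r * t)) : ℂ) * jostDensity κ m t)) (Ioi 0) :=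
    ((i2.const_mul _).add (i1.const_mul _)).add (i0.const_mul _)
  have h := integral_Ioi_of_hasDerivAt_of_tendsto hcont hder hint
    (tendsto_exp_mul_jostDensity hκ (m + 1) hr)
  rw [integral_add, integral_add, integral_const_mul, integral_const_mul, integral_const_mul] at h
  rotate_left
  · exact i2.const_mul _
  · exact i1.const_mul _
  · exact (i2.const_mul _).add (i1.const_mul _)
  · exact i0.const_mul _
  have hz : (m + 1 : ℂ) ≠ 0 := fun h0 => by
    have := congrArg Complex.re h0
    simp at this
    linarith
  have h0 : jostDensity κ (m + 1) 0 = 0 := by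
    simp [jostDensity, Complex.zero_cpow hz]
  rw [h0] at h
  simp only [laplace]
  linear_combination -h

/-- The solution of `u'' = (m (m + 1) / r² - 1) u` on `(0, ∞)` with `u ∼ e^{κ r}`. -/
noncomputable def exteriorJost (κ m : ℂ) (r : ℝ) : ℂ :=
  (r : ℂ) ^ (m + 1) * Complex.exp (κ * r) * laplace (jostDensity κ m) r /
    ((-(2 * κ)) ^ m * Complex.Gamma (m + 1))

/-- Watson's lemma at leading order: after `t ↦ t/r` the factor `(t/r - 2κ)^m` tends to `(-2κ)^m`,
and a Gamma integral remains by dominated convergence. This limit is the normalising constant of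
`exteriorJost`. -/
theorem tendsto_cpow_mul_laplace_jostDensity (hκ : κ = Complex.I ∨ κ = -Complex.I)
    (hm : -1 < m.re) :
    Tendsto (fun r : ℝ => (r : ℂ) ^ (m + 1) * laplace (jostDensity κ m) r) atTop
      (𝓝 ((-(2 * κ)) ^ m * Complex.Gamma (m + 1))) := by
  have hG : (-(2 * κ)) ^ m * Complex.Gamma (m + 1) =
      ∫ t in Ioi (0 : ℝ), (Real.exp (-t) : ℂ) * ((t : ℂ) ^ m * (-(2 * κ)) ^ m) := by
    rw [Complex.Gamma_eq_integral (by simpa using by linarith), Complex.GammaIntegral,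
      ← integral_const_mul]
    refine setIntegral_congr_fun measurableSet_Ioi fun t _ => ?_
    simp only [add_sub_cancel_right]
    ring
  have hscale : ∀ r : ℝ, 0 < r → (r : ℂ) ^ (m + 1) * laplace (jostDensity κ m) r =
      ∫ t in Ioi (0 : ℝ), (Real.exp (-t) : ℂ) *
        ((t : ℂ) ^ m * (((t / r : ℝ) : ℂ) - 2 * κ) ^ m) := by
    intro r hr
    have hr0 : (r : ℂ) ≠ 0 := by exact_mod_cast hr.ne'
    have h := integral_comp_mul_left_Ioi (fun t : ℝ => (Real.exp (-t) : ℂ) *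
        ((t : ℂ) ^ m * (((t / r : ℝ) : ℂ) - 2 * κ) ^ m)) 0 hr
    rw [mul_zero] at h
    have h2 : (∫ t in Ioi (0 : ℝ), (Real.exp (-t) : ℂ) *
        ((t : ℂ) ^ m * (((t / r : ℝ) : ℂ) - 2 * κ) ^ m)) =
        (r : ℂ) * ∫ t in Ioi (0 : ℝ), (Real.exp (-(r * t)) : ℂ) *
        (((r * t : ℝ) : ℂ) ^ m * (((r * t / r : ℝ) : ℂ) - 2 * κ) ^ m) := by
      rw [h, Complex.real_smul, ← mul_assoc]
      push_cast
      rw [mul_inv_cancel₀ hr0, one_mul]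
    rw [h2, laplace, Complex.cpow_add _ _ hr0, Complex.cpow_one, mul_comm _ (r : ℂ), mul_assoc,
      ← integral_const_mul]
    congr 1
    refine setIntegral_congr_fun measurableSet_Ioi fun t ht => ?_
    simp only [jostDensity]
    rw [mul_div_cancel_left₀ _ hr.ne', Complex.ofReal_mul,
      Complex.mul_cpow_ofReal_nonneg hr.le (le_of_lt ht)]
    ring
  rw [hG]
  refine Tendsto.congr' (f₁ := fun r : ℝ => ∫ t in Ioi (0 : ℝ), (Real.exp (-t) : ℂ) *
        ((t : ℂ) ^ m * (((t / r : ℝ) : ℂ) - 2 * κ) ^ m)) ?_ ?_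
  · filter_upwards [eventually_gt_atTop 0] with r hr using (hscale r hr).symm
  refine tendsto_integral_filter_of_dominated_convergence (fun t : ℝ =>
    Real.exp (Real.pi * |m.im|) * (t ^ m.re * (t + 2) ^ ⌈|m.re|⌉₊ * Real.exp (-(1 * t)))) ?_ ?_
    ((integrableOn_rpow_mul_pow_mul_exp hm one_pos _).const_mul _) ?_
  · refine Eventually.of_forall fun r => ?_
    refine ContinuousOn.aestronglyMeasurable ?_ measurableSet_Ioi
    refine ContinuousOn.mul (by fun_prop) (ContinuousOn.mul ?_ ?_)
    · exact ContinuousOn.cpow Complex.continuous_ofReal.continuousOn continuousOn_const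
        fun t ht => Or.inl (by simpa using ht)
    · exact ((continuous_cpow_sub hκ m).comp (continuous_id.div_const r)).continuousOn
  · filter_upwards [eventually_ge_atTop (1 : ℝ)] with r hr
    refine (ae_restrict_iff' measurableSet_Ioi).2 (ae_of_all _ fun t ht => ?_)
    have ht0 : 0 < t := ht
    have h := norm_cpow_sub_le hκ m (div_nonneg ht0.le (by linarith)) (div_le_self ht0.le hr)
    simp only [norm_mul, Complex.norm_real, Real.norm_of_nonneg (Real.exp_pos _).le,
      Complex.norm_cpow_eq_rpow_re_of_pos ht0, one_mul]
    calc Real.exp (-t) * (t ^ m.re * ‖(((t / r : ℝ) : ℂ) - 2 * κ) ^ m‖)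
        ≤ Real.exp (-t) * (t ^ m.re *
          (Real.exp (Real.pi * |m.im|) * (t + 2) ^ ⌈|m.re|⌉₊)) := by gcongr
      _ = _ := by ring
  · refine ae_of_all _ fun t => ?_
    have h1 : Tendsto (fun r : ℝ => t / r) atTop (𝓝 0) := tendsto_const_nhds.div_atTop tendsto_id
    have h2 := ((continuous_cpow_sub hκ m).tendsto 0).comp h1
    simp only [Complex.ofReal_zero, zero_sub] at h2
    exact (h2.const_mul _).const_mul _

theorem exteriorJost_isJost (hκ : κ = Complex.I ∨ κ = -Complex.I) (hm : -1 < m.re) {b : ℝ}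
    (hb : 0 < b) {k : ℝ → ℂ} (hk : ∀ r, b < r → k r = m * (m + 1) / (r : ℂ) ^ 2 - 1) :
    ∃ du, IsJost k b κ (exteriorJost κ m) du := by
  have hκ2 : κ * κ = -1 := by rcases hκ with rfl | rfl <;> simp
  have hκ0 : -(2 * κ) ≠ 0 := by rcases hκ with rfl | rfl <;> simp
  set L : ℂ := (-(2 * κ)) ^ m * Complex.Gamma (m + 1) with hL
  have hL0 : L ≠ 0 := mul_ne_zero (by simp [Complex.cpow_eq_zero_iff, hκ0])
    (Complex.Gamma_ne_zero_of_re_pos (by simpa using by linarith))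
  have hg := laplaceIntegrable_jostDensity hκ hm
  set G0 := laplace (jostDensity κ m) with hG0
  set G1 := laplace (fun t => (t : ℂ) * jostDensity κ m t) with hG1
  set G2 := laplace (fun t => (t : ℂ) * ((t : ℂ) * jostDensity κ m t)) with hG2
  have d0 : ∀ r : ℝ, 0 < r → HasDerivAt G0 (-G1 r) r := fun r hr => hg.hasDerivAt hr
  have d1 : ∀ r : ℝ, 0 < r → HasDerivAt G1 (-G2 r) r := fun r hr => hg.mul_id.hasDerivAt hr
  have hofR : ∀ r : ℝ, HasDerivAt (fun r : ℝ => (r : ℂ)) 1 r := fun r =>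
    Complex.ofRealCLM.hasDerivAt (x := r)
  have dA : ∀ r : ℝ, 0 < r → HasDerivAt (fun r : ℝ => (r : ℂ) ^ (m + 1) * Complex.exp (κ * r))
      (((m + 1) / r + κ) * ((r : ℂ) ^ (m + 1) * Complex.exp (κ * r))) r := by
    intro r hr
    have hr0 : (r : ℂ) ≠ 0 := by exact_mod_cast hr.ne'
    have e1 : HasDerivAt (fun t : ℝ => (t : ℂ) ^ (m + 1)) ((m + 1) * (r : ℂ) ^ (m + 1 - 1) * 1) r :=
      ((hasDerivAt_id (r : ℂ)).cpow_const (Or.inl (by simpa using hr))).comp_ofReal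
    refine (e1.mul ((hofR r).const_mul κ).cexp).congr_deriv ?_
    rw [add_sub_cancel_right, Complex.cpow_add _ _ hr0, Complex.cpow_one]
    field_simp
  have dB : ∀ r : ℝ, 0 < r → HasDerivAt (fun r : ℝ => (m + 1) / (r : ℂ) + κ)
      (-(m + 1) / (r : ℂ) ^ 2) r := by
    intro r hr
    have hr0 : (r : ℂ) ≠ 0 := by exact_mod_cast hr.ne'
    refine (((hasDerivAt_const r (m + 1)).div (hofR r) hr0).add_const κ).congr_deriv ?_
    ring
  have hd : ∀ r : ℝ, 0 < r → HasDerivAt (exteriorJost κ m) ((r : ℂ) ^ (m + 1) * Complex.exp (κ * r) *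
      (((m + 1) / r + κ) * G0 r - G1 r) / L) r := by
    intro r hr
    refine (((dA r hr).mul (d0 r hr)).div_const L).congr_deriv ?_
    ring
  have hdd : ∀ r : ℝ, 0 < r → HasDerivAt (fun r : ℝ => (r : ℂ) ^ (m + 1) * Complex.exp (κ * r) *
      (((m + 1) / r + κ) * G0 r - G1 r) / L)
      ((m * (m + 1) / (r : ℂ) ^ 2 - 1) * exteriorJost κ m r) r := by
    intro r hr
    have hr0 : (r : ℂ) ≠ 0 := by exact_mod_cast hr.ne'
    refine (((dA r hr).mul (((dB r hr).mul (d0 r hr)).sub (d1 r hr))).div_const L).congr_deriv ?_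
    have hode := laplace_jostDensity_ode hκ hm hr
    rw [← hG0, ← hG1, ← hG2] at hode
    -- Eliminating the second moment reduces the differential equation to an algebraic identity that
    -- only uses `κ² = -1`.
    have hode' : G2 r = 2 * κ * G1 r + (m + 1) * (2 * G1 r - 2 * κ * G0 r) / r := by
      field_simp
      linear_combination hode
    simp only [exteriorJost, ← hG0, ← hL, Pi.mul_apply, Pi.sub_apply]
    rw [hode']
    field_simp
    linear_combination ((r : ℂ) ^ (m + 1) * G0 r * (r : ℂ) ^ 2) * hκ2
  refine ⟨_, ⟨fun r hr => (hdd r (hb.trans_le hr)).continuousAt.continuousWithinAt,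
    fun r hr => (hd r (hb.trans_le hr)).hasDerivWithinAt, ∅, finite_empty, fun r hr _ => ?_⟩, ?_⟩
  · rw [hk r hr]
    exact hdd r (hb.trans hr)
  · have h1 := ((tendsto_cpow_mul_laplace_jostDensity hκ hm).div_const L).sub_const 1
    rw [← hL, div_self hL0, sub_self] at h1
    have hnorm := norm_exp_mul_ofReal hκ
    rw [tendsto_zero_iff_norm_tendsto_zero] at h1 ⊢
    refine h1.congr fun r => ?_
    rw [← mul_one ‖_ - 1‖, ← hnorm r, ← norm_mul]
    congr 1
    simp only [exteriorJost, ← hL]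
    ring

end Exterior

/-! ### The phase of the exterior Jost solution for real order -/

/-- The integral `∫₀^∞ e^{-rx} (x² + 1)^m dx`. -/
noncomputable def growthIntegral (m r : ℝ) : ℝ :=
  ∫ x in Ioi (0 : ℝ), Real.exp (-(r * x)) * (x ^ 2 + 1) ^ m

theorem sq_add_one_rpow_le {m x : ℝ} (hm : 0 ≤ m) (hx : 0 ≤ x) :
    (x ^ 2 + 1) ^ m ≤ (x + 2) ^ (2 * ⌈m⌉₊) := by
  calc (x ^ 2 + 1) ^ m ≤ ((x + 2) ^ 2) ^ m :=
        Real.rpow_le_rpow (by positivity) (by nlinarith) hm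
    _ ≤ ((x + 2) ^ 2) ^ ((⌈m⌉₊ : ℕ) : ℝ) :=
        Real.rpow_le_rpow_of_exponent_le (by nlinarith) (Nat.le_ceil _)
    _ = _ := by rw [Real.rpow_natCast, pow_mul]

theorem integrableOn_growthIntegral {m r : ℝ} (hm : 0 ≤ m) (hr : 0 < r) :
    IntegrableOn (fun x : ℝ => Real.exp (-(r * x)) * (x ^ 2 + 1) ^ m) (Ioi 0) := by
  refine Integrable.mono' (integrableOn_rpow_mul_pow_mul_exp (s := 0) (by norm_num) hr
    (2 * ⌈m⌉₊)) (Measurable.aestronglyMeasurable (by fun_prop)) ?_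
  refine (ae_restrict_iff' measurableSet_Ioi).2 (ae_of_all _ fun x hx => ?_)
  have hx0 : 0 < x := hx
  rw [Real.norm_of_nonneg (by positivity), Real.rpow_zero, one_mul, mul_comm]
  exact mul_le_mul_of_nonneg_right (sq_add_one_rpow_le hm hx0.le) (Real.exp_pos _).le

/-- Only `[3, 4]` is kept, where `x² + 1 ≥ 10`. The base `10` is chosen to beat the `2^m` and
`(9/2)^m` error terms when values at `b` and `2b` are compared. -/
theorem le_growthIntegral {m r : ℝ} (hm : 0 ≤ m) (hr : 0 < r) :
    Real.exp (-(4 * r)) * 10 ^ m ≤ growthIntegral m r := by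
  have h1 : ∫ _ in Ioc (3 : ℝ) 4, Real.exp (-(4 * r)) * (10 : ℝ) ^ m =
      Real.exp (-(4 * r)) * 10 ^ m := by
    simp; norm_num
  rw [← h1, growthIntegral]
  have hsub : Ioc (3 : ℝ) 4 ⊆ Ioi 0 := fun x hx => lt_trans (by norm_num) hx.1
  refine (setIntegral_mono_on (integrableOn_const (by simp)) ((integrableOn_growthIntegral hm hr).mono_set hsub)
    measurableSet_Ioc fun x hx => ?_).trans
    (setIntegral_mono_set (integrableOn_growthIntegral hm hr) (ae_of_all _ fun x => ?_)
      hsub.eventuallyLE)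
  · have h3 : (10 : ℝ) ≤ x ^ 2 + 1 := by nlinarith [hx.1]
    exact mul_le_mul (Real.exp_le_exp.2 (by nlinarith [hx.2]))
      (Real.rpow_le_rpow (by norm_num) h3 hm) (by positivity) (by positivity)
  · show (0 : ℝ) ≤ _
    positivity

/-- The factor `2^(m+1)` is the ratio of the prefactors `r^(m+1)` at `2r` and `r`, so this estimate
yields the decrease of the solution between the two points. The substitution `y = 2x` replaces `y² +
1` by `y²/4 + 1`, which is smaller by a factor `3/8` once `y² ≥ 5`. -/
theorem growthIntegral_two_mul_le {m r : ℝ} (hm : 0 ≤ m) (hr : 0 < r) :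
    2 ^ (m + 1) * growthIntegral m (2 * r) ≤
      (3 / 4) ^ m * growthIntegral m r + 3 * (9 / 2) ^ m := by
  have h := integral_comp_mul_left_Ioi
    (fun y : ℝ => Real.exp (-(r * y)) * (y ^ 2 / 4 + 1) ^ m) 0 (two_pos : (0 : ℝ) < 2)
  have h1 : growthIntegral m (2 * r) =
      2⁻¹ * ∫ y in Ioi (0 : ℝ), Real.exp (-(r * y)) * (y ^ 2 / 4 + 1) ^ m := by
    rw [mul_zero, smul_eq_mul] at h
    rw [← h, growthIntegral]
    refine setIntegral_congr_fun measurableSet_Ioi fun y _ => ?_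
    ring_nf
  have hI := integrableOn_growthIntegral hm hr
  have hJ : IntegrableOn (indicator (Ioc (0 : ℝ) 3) fun _ => (9 / 4 : ℝ) ^ m) (Ioi 0) := by
    rw [integrableOn_indicator_iff measurableSet_Ioc]
    refine (integrableOn_const (by simp)).mono_set inter_subset_left
  have hle : ∫ y in Ioi (0 : ℝ), Real.exp (-(r * y)) * (y ^ 2 / 4 + 1) ^ m ≤
      ∫ y in Ioi (0 : ℝ), ((3 / 8) ^ m * (Real.exp (-(r * y)) * (y ^ 2 + 1) ^ m) +
        indicator (Ioc (0 : ℝ) 3) (fun _ => (9 / 4 : ℝ) ^ m) y) := by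
    refine integral_mono_of_nonneg (ae_of_all _ fun y => ?_) ((hI.const_mul _).add hJ) ?_
    · show (0 : ℝ) ≤ _
      positivity
    · refine (ae_restrict_iff' measurableSet_Ioi).2 (ae_of_all _ fun y hy => ?_)
      have hy0 : 0 < y := hy
      -- At `y² = 5` both `y²/4 + 1` and `(3/8)(y² + 1)` equal `9/4`; below this threshold `y ≤ 3`
      -- and the bound `(9/4)^m` suffices.
      by_cases h5 : 5 ≤ y ^ 2
      · have h6 : (y ^ 2 / 4 + 1) ^ m ≤ (3 / 8) ^ m * (y ^ 2 + 1) ^ m := by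
          rw [← Real.mul_rpow (by norm_num) (by positivity)]
          exact Real.rpow_le_rpow (by positivity) (by linarith) hm
        have h7 : 0 ≤ indicator (Ioc (0 : ℝ) 3) (fun _ => (9 / 4 : ℝ) ^ m) y :=
          indicator_nonneg (fun _ _ => by positivity) _
        have h8 := mul_le_mul_of_nonneg_left h6 (Real.exp_pos (-(r * y))).le
        simp only
        linarith
      · push Not at h5
        have hy3 : y ∈ Ioc (0 : ℝ) 3 := ⟨hy0, by nlinarith⟩
        simp only [indicator_of_mem hy3]
        have h6 : (y ^ 2 / 4 + 1) ^ m ≤ (9 / 4) ^ m :=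
          Real.rpow_le_rpow (by positivity) (by linarith) hm
        have h7 : Real.exp (-(r * y)) ≤ 1 := Real.exp_le_one_iff.2 (by nlinarith)
        have h8 : Real.exp (-(r * y)) * (y ^ 2 / 4 + 1) ^ m ≤ 1 * (9 / 4) ^ m :=
          mul_le_mul h7 h6 (by positivity) zero_le_one
        have h9 : 0 ≤ (3 / 8 : ℝ) ^ m * (Real.exp (-(r * y)) * (y ^ 2 + 1) ^ m) := by positivity
        linarith
  have hJ2 : ∫ y in Ioi (0 : ℝ), indicator (Ioc (0 : ℝ) 3) (fun _ => (9 / 4 : ℝ) ^ m) y =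
      3 * (9 / 4) ^ m := by
    rw [setIntegral_indicator measurableSet_Ioc,
      inter_eq_right.2 (Ioc_subset_Ioi_self : Ioc (0 : ℝ) 3 ⊆ Ioi 0)]
    simp
  rw [integral_add (hI.const_mul _) hJ, integral_const_mul, hJ2, ← growthIntegral] at hle
  rw [h1, Real.rpow_add two_pos, Real.rpow_one]
  have e1 : (3 / 4 : ℝ) ^ m = 2 ^ m * (3 / 8) ^ m := by
    rw [← Real.mul_rpow (by norm_num) (by norm_num)]; norm_num
  have e2 : (9 / 2 : ℝ) ^ m = 2 ^ m * (9 / 4) ^ m := by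
    rw [← Real.mul_rpow (by norm_num) (by norm_num)]; norm_num
  rw [e1, e2]
  have := mul_le_mul_of_nonneg_left hle (by positivity : (0 : ℝ) ≤ 2 ^ m)
  linarith

theorem ofReal_mul_cpow {x : ℝ} (hx : 0 < x) {z : ℂ} (hz : z ≠ 0) (m : ℂ) :
    ((x : ℂ) * z) ^ m = (x : ℂ) ^ m * z ^ m := by
  have hx0 : (x : ℂ) ≠ 0 := by exact_mod_cast hx.ne'
  rw [Complex.cpow_def_of_ne_zero (mul_ne_zero hx0 hz), Complex.cpow_def_of_ne_zero hx0,
    Complex.cpow_def_of_ne_zero hz, Complex.log_ofReal_mul hx hz, Complex.ofReal_log hx.le,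
    ← Complex.exp_add, add_mul]

theorem norm_cpow_ofReal_le (z : ℂ) (m : ℝ) : ‖z ^ (m : ℂ)‖ ≤ ‖z‖ ^ m := by
  have h := Complex.norm_cpow_le z (m : ℂ)
  simp only [Complex.ofReal_re, Complex.ofReal_im, mul_zero, Real.exp_zero, div_one] at h
  exact h

/-- Shifting the contour of the Laplace integral by `i` makes it real up to a bounded error. -/
theorem exp_mul_laplace_jostDensity {m r : ℝ} (hm : 0 < m) (hr : 0 < r) :
    ∃ E : ℂ, ‖E‖ ≤ 1 ∧ Complex.exp (Complex.I * r) * laplace (jostDensity Complex.I m) r =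
      growthIntegral m r + E := by
  set f : ℂ → ℂ := fun z => Complex.exp (-(r * z)) * (z ^ 2 + 1) ^ (m : ℂ) with hf
  have hre : ∀ z : ℂ, (z ^ 2 + 1).re = z.re ^ 2 - z.im ^ 2 + 1 := fun z => by
    simp [sq]
  -- Cauchy's theorem on the rectangle with corners `-i` and `X`. On the bottom side `z = x - i` one
  -- has `z² + 1 = x(x - 2i)`, which gives the Jost density; on the top side the integrand is real.
  have hrect : ∀ X : ℝ, 0 ≤ X →
      (∫ x in (0 : ℝ)..X, f (x + (-1 : ℝ) * Complex.I)) - (∫ x in (0 : ℝ)..X, f (x + (0 : ℝ) * Complex.I)) +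
        Complex.I • (∫ y in (-1 : ℝ)..0, f (X + y * Complex.I)) -
        Complex.I • (∫ y in (-1 : ℝ)..0, f ((0 : ℝ) + y * Complex.I)) = 0 := by
    intro X hX
    have h := Complex.integral_boundary_rect_eq_zero_of_continuousOn_of_differentiableOn f
      (-Complex.I) (X : ℂ) ?_ ?_
    · simpa using h
    · intro z hz
      rw [Complex.mem_reProdIm] at hz
      simp only [Complex.neg_re, Complex.I_re, neg_zero, Complex.ofReal_re, Complex.neg_im,
        Complex.I_im, Complex.ofReal_im, uIcc_of_le hX,
        uIcc_of_le (by norm_num : (-1 : ℝ) ≤ 0)] at hz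
      -- On the closed rectangle `Re(z² + 1) ≥ 0`, with a zero of `z² + 1` at the corner `-i`;
      -- continuity of the power there needs `m > 0`.
      refine ContinuousAt.continuousWithinAt (ContinuousAt.mul (by fun_prop) ?_)
      refine ContinuousAt.comp (f := fun z : ℂ => z ^ 2 + 1) (g := fun z : ℂ => z ^ (m : ℂ))
        (Complex.continuousAt_cpow_const_of_re_pos (Or.inl ?_) (by simpa using hm)) (by fun_prop)
      rw [hre]
      nlinarith [hz.2.1, hz.2.2, sq_nonneg z.re]
    · intro z hz
      rw [Complex.mem_reProdIm] at hz
      simp only [Complex.neg_re, Complex.I_re, neg_zero, Complex.ofReal_re, Complex.neg_im,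
        Complex.I_im, Complex.ofReal_im, min_eq_left hX, max_eq_right hX,
        min_eq_left (by norm_num : (-1 : ℝ) ≤ 0), max_eq_right (by norm_num : (-1 : ℝ) ≤ 0)] at hz
      refine DifferentiableAt.differentiableWithinAt (DifferentiableAt.mul (by fun_prop) ?_)
      refine DifferentiableAt.cpow_const (by fun_prop) (Or.inl ?_)
      rw [hre]
      nlinarith [hz.2.1, hz.2.2, sq_nonneg z.re]
  have hbot : ∀ x : ℝ, 0 < x → f (x + (-1 : ℝ) * Complex.I) =
      Complex.exp (Complex.I * r) * ((Real.exp (-(r * x)) : ℂ) * jostDensity Complex.I m x) := by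
    intro x hx
    have h1 : ((x : ℂ) + (-1 : ℝ) * Complex.I) ^ 2 + 1 = (x : ℂ) * ((x : ℂ) - 2 * Complex.I) := by
      push_cast
      linear_combination Complex.I_sq
    have h2 : -((r : ℂ) * ((x : ℂ) + (-1 : ℝ) * Complex.I)) = Complex.I * r + -(r * x) := by
      push_cast; ring
    simp only [hf]
    rw [h1, h2, Complex.exp_add, ofReal_mul_cpow hx
      (Complex.slitPlane_ne_zero (sub_mem_slitPlane (Or.inl rfl) x)), jostDensity]
    push_cast
    ring
  have htop : ∀ x : ℝ, f (x + (0 : ℝ) * Complex.I) =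
      ((Real.exp (-(r * x)) * (x ^ 2 + 1) ^ m : ℝ) : ℂ) := by
    intro x
    simp only [hf]
    push_cast
    rw [Complex.ofReal_cpow (by positivity)]
    push_cast
    simp
  have hlap := laplaceIntegrable_jostDensity (κ := Complex.I) (m := m) (Or.inl rfl)
    (by simp; linarith)
  have l1 : Tendsto (fun X : ℝ => ∫ x in (0 : ℝ)..X, f (x + (-1 : ℝ) * Complex.I)) atTop
      (𝓝 (Complex.exp (Complex.I * r) * laplace (jostDensity Complex.I m) r)) := by
    have h := intervalIntegral_tendsto_integral_Ioi 0
      ((hlap r hr).const_mul (Complex.exp (Complex.I * r))) tendsto_id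
    rw [integral_const_mul] at h
    refine h.congr' ?_
    filter_upwards [eventually_ge_atTop 0] with X hX
    refine intervalIntegral.integral_congr_ae (ae_of_all _ fun x hx => ?_)
    rw [id, uIoc_of_le hX] at hx
    exact (hbot x hx.1).symm
  have l2 : Tendsto (fun X : ℝ => ∫ x in (0 : ℝ)..X, f (x + (0 : ℝ) * Complex.I)) atTop
      (𝓝 (growthIntegral m r)) := by
    simp only [htop]
    have hi : IntegrableOn (fun x : ℝ => ((Real.exp (-(r * x)) * (x ^ 2 + 1) ^ m : ℝ) : ℂ))
      (Ioi 0) := (integrableOn_growthIntegral hm.le hr).ofReal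
    have h := intervalIntegral_tendsto_integral_Ioi 0 hi tendsto_id
    rw [integral_complex_ofReal] at h
    exact h
  have l3 : Tendsto (fun X : ℝ => ∫ y in (-1 : ℝ)..0, f (X + y * Complex.I)) atTop (𝓝 0) := by
    refine squeeze_zero_norm' ?_
      (tendsto_add_two_pow_mul_exp hr (2 * ⌈m⌉₊) (Real.exp (2 * r)))
    filter_upwards [eventually_ge_atTop 0] with X hX
    have hb : ∀ y ∈ uIoc (-1 : ℝ) 0, ‖f (X + y * Complex.I)‖ ≤ Real.exp (2 * r) *
        ((X + 2) ^ (2 * ⌈m⌉₊) * Real.exp (-r * (X + 2))) := by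
      intro y hy
      rw [uIoc_of_le (by norm_num)] at hy
      have h1 : ‖(X : ℂ) + y * Complex.I‖ ≤ X + 1 := by
        refine (norm_add_le _ _).trans ?_
        simp only [Complex.norm_real, norm_mul, Complex.norm_I, mul_one, Real.norm_of_nonneg hX]
        have : ‖y‖ ≤ 1 := abs_le.2 ⟨hy.1.le, by linarith [hy.2]⟩
        linarith
      have h2 : ‖((X : ℂ) + y * Complex.I) ^ 2 + 1‖ ≤ (X + 1) ^ 2 + 1 := by
        refine (norm_add_le _ _).trans ?_
        rw [norm_pow, norm_one]
        gcongr
      have h3 : ((X + 1) ^ 2 + 1) ^ m ≤ (X + 2) ^ (2 * ⌈m⌉₊) := by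
        calc ((X + 1) ^ 2 + 1) ^ m ≤ ((X + 2) ^ 2) ^ m :=
              Real.rpow_le_rpow (by positivity) (by nlinarith) hm.le
          _ ≤ ((X + 2) ^ 2) ^ ((⌈m⌉₊ : ℕ) : ℝ) :=
              Real.rpow_le_rpow_of_exponent_le (by nlinarith) (Nat.le_ceil _)
          _ = _ := by rw [Real.rpow_natCast, pow_mul]
      have h4 : ‖Complex.exp (-(r * ((X : ℂ) + y * Complex.I)))‖ =
          Real.exp (2 * r) * Real.exp (-r * (X + 2)) := by
        rw [Complex.norm_exp, ← Real.exp_add]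
        congr 1
        simp
        ring
      simp only [hf]
      rw [norm_mul, h4]
      calc Real.exp (2 * r) * Real.exp (-r * (X + 2)) *
            ‖(((X : ℂ) + y * Complex.I) ^ 2 + 1) ^ (m : ℂ)‖
          ≤ Real.exp (2 * r) * Real.exp (-r * (X + 2)) * (X + 2) ^ (2 * ⌈m⌉₊) := by
            gcongr
            exact (norm_cpow_ofReal_le _ m).trans
              ((Real.rpow_le_rpow (norm_nonneg _) h2 hm.le).trans h3)
        _ = _ := by ring
    have := intervalIntegral.norm_integral_le_of_norm_le_const hb
    simpa using this
  set J : ℂ := ∫ y in (-1 : ℝ)..0, f ((0 : ℝ) + y * Complex.I) with hJ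
  have hJ1 : ‖J‖ ≤ 1 := by
    have hb : ∀ y ∈ uIoc (-1 : ℝ) 0, ‖f ((0 : ℝ) + y * Complex.I)‖ ≤ 1 := by
      intro y hy
      rw [uIoc_of_le (by norm_num)] at hy
      simp only [hf]
      have h1 : ‖Complex.exp (-(r * (((0 : ℝ) : ℂ) + y * Complex.I)))‖ = 1 := by
        rw [Complex.norm_exp]; simp
      -- On the left side, of length one, the exponential has modulus one and `z² + 1` lies in `[0,
      -- 1]`; hence the error is at most `1` uniformly in `m` and `r`.
      have h2 : (((0 : ℝ) : ℂ) + y * Complex.I) ^ 2 + 1 = ((1 - y ^ 2 : ℝ) : ℂ) := by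
        push_cast
        linear_combination (y : ℂ) ^ 2 * Complex.I_sq
      rw [norm_mul, h1, one_mul, h2]
      refine (norm_cpow_ofReal_le _ m).trans (Real.rpow_le_one (norm_nonneg _) ?_ hm.le)
      rw [Complex.norm_real, Real.norm_of_nonneg (by nlinarith [hy.1, hy.2])]
      nlinarith
    have h := intervalIntegral.norm_integral_le_of_norm_le_const hb
    rwa [← hJ, sub_neg_eq_add, zero_add, abs_one, mul_one] at h
  refine ⟨Complex.I * J, by simpa using hJ1, ?_⟩
  have hlim := ((l1.sub l2).add (l3.const_smul Complex.I)).sub_const (Complex.I • J)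
  have h0 : Tendsto (fun _ : ℝ => (0 : ℂ)) atTop (𝓝 0) := tendsto_const_nhds
  have := tendsto_nhds_unique (hlim.congr' (by
    filter_upwards [eventually_ge_atTop 0] with X hX using hrect X hX)) h0
  simp only [smul_eq_mul, mul_zero] at this
  linear_combination this

/-- The phase comes solely from the normalisation, as `(-2i)^m = 2^m e^{-iπm/2}`. The remaining
constants are positive, and the contour shift handles the integral. -/
theorem exteriorJost_phase {m : ℝ} (hm : 0 < m) :
    ∃ C : ℝ, 0 < C ∧ ∀ r : ℝ, 0 < r → ∃ E : ℂ, ‖E‖ ≤ 1 ∧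
      exteriorJost Complex.I m r = Complex.exp (Complex.I * Real.pi * (m / 2)) *
        ((C * r ^ (m + 1) : ℝ) * (growthIntegral m r + E)) := by
  have hL : (-(2 * Complex.I)) ^ (m : ℂ) =
      ((2 ^ m : ℝ) : ℂ) * (Complex.exp (Complex.I * Real.pi * (m / 2)))⁻¹ := by
    have h1 : (-(2 * Complex.I)) = ((2 : ℝ) : ℂ) * (-Complex.I) := by push_cast; ring
    rw [h1, ofReal_mul_cpow two_pos (by simp), Complex.ofReal_cpow two_pos.le,
      Complex.cpow_def_of_ne_zero (x := -Complex.I) (by simp), Complex.log_neg_I, ← Complex.exp_neg]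
    congr 2
    ring
  have hG : Complex.Gamma (m + 1) = ((Real.Gamma (m + 1) : ℝ) : ℂ) := by
    rw [← Complex.Gamma_ofReal]; push_cast; rfl
  have hG0 : 0 < Real.Gamma (m + 1) := Real.Gamma_pos_of_pos (by linarith)
  refine ⟨(2 ^ m * Real.Gamma (m + 1))⁻¹, by positivity, fun r hr => ?_⟩
  obtain ⟨E, hE, h⟩ := exp_mul_laplace_jostDensity hm hr
  refine ⟨E, hE, ?_⟩
  rw [exteriorJost, mul_assoc ((r : ℂ) ^ _), h, hL, hG, Complex.ofReal_mul, Complex.ofReal_inv,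
    Complex.ofReal_mul, Complex.ofReal_cpow hr.le]
  push_cast
  have e1 : ((2 : ℂ) ^ (m : ℂ)) ≠ 0 := by simp [Complex.cpow_eq_zero_iff]
  have e2 : ((Real.Gamma (m + 1) : ℝ) : ℂ) ≠ 0 := by exact_mod_cast hG0.ne'
  have e3 := Complex.exp_ne_zero (Complex.I * Real.pi * (m / 2))
  field_simp

/-! ### Real potentials and the barrier estimate -/

theorem IsSolution.const_mul {k : ℝ → ℂ} {a : ℝ} {u du : ℝ → ℂ} (h : IsSolution k a u du)
    (c : ℂ) : IsSolution k a (fun r => c * u r) (fun r => c * du r) := by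
  obtain ⟨S, hS, hd⟩ := h.2.2
  refine ⟨continuousOn_const.mul h.1, fun r hr => (h.2.1 r hr).const_mul c, S, hS,
    fun r hr hrS => ((hd r hr hrS).const_mul c).congr_deriv (by ring)⟩

theorem IsSolution.conj {k : ℝ → ℂ} {a : ℝ} {u du : ℝ → ℂ} (h : IsSolution k a u du)
    (hk : ∀ r, a < r → (k r).im = 0) :
    IsSolution k a (fun r => starRingEnd ℂ (u r)) (fun r => starRingEnd ℂ (du r)) := by
  obtain ⟨S, hS, hd⟩ := h.2.2
  refine ⟨Complex.continuous_conj.comp_continuousOn h.1, fun r hr => ?_, S, hS,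
    fun r hr hrS => ?_⟩
  · exact (Complex.conjCLE.toContinuousLinearMap.hasFDerivAt (x := u r)).comp_hasDerivWithinAt r
      (h.2.1 r hr)
  · refine ((Complex.conjCLE.toContinuousLinearMap.hasFDerivAt (x := du r)).comp_hasDerivAt r
      (hd r hr hrS)).congr_deriv ?_
    have h1 : starRingEnd ℂ (k r) = k r := Complex.conj_eq_iff_im.2 (hk r hr)
    simp [h1]

theorem IsJost.conj {k : ℝ → ℂ} {a : ℝ} {κ : ℂ} {u du : ℝ → ℂ} (h : IsJost k a κ u du)
    (hκ : κ = Complex.I ∨ κ = -Complex.I) (hk : ∀ r, a < r → (k r).im = 0) :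
    IsJost k a (-κ) (fun r => starRingEnd ℂ (u r)) (fun r => starRingEnd ℂ (du r)) := by
  refine ⟨h.1.conj hk, ?_⟩
  have h1 := h.2
  rw [tendsto_zero_iff_norm_tendsto_zero] at h1 ⊢
  refine h1.congr fun r => ?_
  have h2 : Complex.exp (-κ * r) = starRingEnd ℂ (Complex.exp (κ * r)) := by
    rw [← Complex.exp_conj]
    rcases hκ with rfl | rfl <;> simp
  rw [h2, ← map_sub, Complex.norm_conj]

/-- For a real nonnegative `k`, the square of the real part of a solution is convex. -/
theorem IsSolution.convexOn_re_sq {k : ℝ → ℂ} {a c : ℝ} {h dh : ℝ → ℂ}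
    (hs : IsSolution k a h dh) (him : ∀ r, a < r → (k r).im = 0)
    (hre : ∀ r ∈ Ioo a c, 0 ≤ (k r).re) : ConvexOn ℝ (Icc a c) fun r => (h r).re ^ 2 := by
  obtain ⟨S, hS, hd⟩ := hs.2.2
  have hP : ∀ r, a < r → HasDerivAt (fun r => (h r).re) (dh r).re r := fun r hr =>
    Complex.reCLM.hasFDerivAt.comp_hasDerivAt r (hs.hasDerivAt hr)
  have hP2 : ∀ r, a < r → HasDerivAt (fun r => (h r).re ^ 2) (2 * ((h r).re * (dh r).re)) r :=
    fun r hr => ((hP r hr).pow 2).congr_deriv (by simp; ring)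
  have hcP : ContinuousOn (fun r => (h r).re) (Ici a) :=
    Complex.continuous_re.comp_continuousOn hs.continuousOn
  have hcdP : ContinuousOn (fun r => (dh r).re) (Ici a) :=
    Complex.continuous_re.comp_continuousOn hs.1
  refine MonotoneOn.convexOn_of_deriv (convex_Icc a c)
    ((hcP.pow 2).mono Icc_subset_Ici_self) ?_ ?_
  · rw [interior_Icc]
    exact fun r hr => (hP2 r hr.1).differentiableAt.differentiableWithinAt
  · rw [interior_Icc]
    intro r hr s hs' hrs
    rw [(hP2 r hr.1).deriv, (hP2 s hs'.1).deriv]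
    refine mul_le_mul_of_nonneg_left ?_ zero_le_two
    -- With `P = Re h`, the derivative of `P P'` is `P'² + k P² ≥ 0` off the finite set.
    refine le_of_hasDerivAt_nonneg_off_finite (f := fun r => (h r).re * (dh r).re)
      (f' := fun x => (dh x).re * (dh x).re + (h x).re * (k x * h x).re) hS hrs
      ((hcP.mul hcdP).mono fun x hx => hr.1.le.trans hx.1) fun x hx hxS => ?_
    have hax := hr.1.trans hx.1
    refine ⟨(hP x hax).mul (Complex.reCLM.hasFDerivAt.comp_hasDerivAt x (hd x hax hxS)), ?_⟩
    rw [Complex.mul_re, him x hax, zero_mul, sub_zero]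
    have h1 := hre x ⟨hax, hx.2.trans hs'.2⟩
    nlinarith [mul_self_nonneg (dh x).re, mul_nonneg h1 (mul_self_nonneg (h x).re)]

/-- If `k ≥ 0` on `[a, c]` and `Re h` decreases from `b` to `c` in absolute value, the ratio
`Im h / Re h` at `a` is controlled by its values at `b` and `c`. -/
theorem IsSolution.abs_im_div_re_le {k : ℝ → ℂ} {a b c : ℝ} {h dh : ℝ → ℂ}
    (hs : IsSolution k a h dh) (hab : a ≤ b) (hbc : b < c)
    (him : ∀ r, a < r → (k r).im = 0) (hre : ∀ r ∈ Ioo a c, 0 ≤ (k r).re)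
    (hne : ∀ r ∈ Icc b c, (h r).re ≠ 0) (hlt : (h c).re ^ 2 < (h b).re ^ 2) :
    (h a).re ≠ 0 ∧ |(h a).im / (h a).re| ≤ |(h b).im / (h b).re| +
      (b - a) / (c - b) * (|(h b).im / (h b).re| + |(h c).im / (h c).re|) := by
  have hconv := hs.convexOn_re_sq him hre
  have hP : ∀ r, a < r → HasDerivAt (fun r => (h r).re) (dh r).re r := fun r hr =>
    Complex.reCLM.hasFDerivAt.comp_hasDerivAt r (hs.hasDerivAt hr)
  have hQ : ∀ r, a < r → HasDerivAt (fun r => (h r).im) (dh r).im r := fun r hr =>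
    Complex.imCLM.hasFDerivAt.comp_hasDerivAt r (hs.hasDerivAt hr)
  -- By convexity the value at `b` is at most the larger of the values at `r` and at `c`, and `hlt`
  -- rules out `c`.
  have hleft : ∀ r ∈ Icc a b, (h b).re ^ 2 ≤ (h r).re ^ 2 := by
    intro r hr
    have h1 := hconv.le_max_of_mem_Icc ⟨hr.1, hr.2.trans hbc.le⟩ ⟨hab.trans hbc.le, le_rfl⟩
      (⟨hr.2, hbc.le⟩ : b ∈ Icc r c)
    rcases le_max_iff.1 h1 with h2 | h2
    · exact h2
    · exact absurd h2 hlt.not_ge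
  have hright : ∀ r ∈ Icc b c, (h r).re ^ 2 ≤ (h b).re ^ 2 := by
    intro r hr
    have h1 := hconv.le_max_of_mem_Icc ⟨hab, hbc.le⟩ ⟨hab.trans hbc.le, le_rfl⟩ hr
    rcases le_max_iff.1 h1 with h2 | h2
    · exact h2
    · exact h2.trans hlt.le
  have hb0 : (h b).re ≠ 0 := hne b ⟨le_rfl, hbc.le⟩
  have hb2 : 0 < (h b).re ^ 2 := by positivity
  have hne' : ∀ r ∈ Icc a c, (h r).re ≠ 0 := by
    intro r hr
    rcases le_total r b with h1 | h1
    · intro h0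
      have := hleft r ⟨hr.1, h1⟩
      rw [h0] at this
      norm_num at this
      exact hb0 this
    · exact hne r ⟨h1, hr.2⟩
  -- The Wronskian of `Re h` and `Im h`; it is constant because the Wronskian of `h` and its
  -- conjugate is, `k` being real.
  set W : ℝ := (h b).re * (dh b).im - (dh b).re * (h b).im with hW
  have hWc : ∀ r, a ≤ r → (h r).re * (dh r).im - (dh r).re * (h r).im = W := by
    intro r hr
    have h1 := congrArg Complex.im (hs.wronskian_eq (hs.conj him) hr hab)
    simp only [Complex.sub_im, Complex.mul_im, Complex.conj_re, Complex.conj_im] at h1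
    rw [hW]
    linarith
  set g : ℝ → ℝ := fun r => (h r).im / (h r).re with hg
  have hgc : ContinuousOn g (Icc a c) :=
    ((Complex.continuous_im.comp_continuousOn hs.continuousOn).mono Icc_subset_Ici_self).div
      ((Complex.continuous_re.comp_continuousOn hs.continuousOn).mono Icc_subset_Ici_self) hne'
  have hgd : ∀ r, a < r → r ≤ c → HasDerivAt g (W / (h r).re ^ 2) r := by
    intro r hr hrc
    refine ((hQ r hr).div (hP r hr) (hne' r ⟨hr.le, hrc⟩)).congr_deriv ?_
    rw [← hWc r hr.le]
    ring
  -- On `[b, c]` the denominator of `g' = W/(Re h)²` is at most its value at `b`, so the mean value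
  -- theorem bounds `W` above by the increment of `g`. On `[a, b]` the denominator is at least that
  -- value, so the same theorem then limits the variation of `g`.
  have hbc' : |W| / (h b).re ^ 2 * (c - b) ≤ |g b| + |g c| := by
    obtain ⟨ξ, hξ, he⟩ := exists_hasDerivAt_eq_slope g (fun r => W / (h r).re ^ 2) hbc
      (hgc.mono (Icc_subset_Icc_left hab)) fun r hr => hgd r (hab.trans_lt hr.1) hr.2.le
    have hcb : 0 < c - b := sub_pos.2 hbc
    rw [eq_div_iff hcb.ne'] at he
    have hξ0 : 0 < (h ξ).re ^ 2 := by
      have := hne ξ (Ioo_subset_Icc_self hξ)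
      positivity
    have h1 : |W| / (h b).re ^ 2 ≤ |W| / (h ξ).re ^ 2 :=
      div_le_div_of_nonneg_left (abs_nonneg _) hξ0 (hright ξ (Ioo_subset_Icc_self hξ))
    calc |W| / (h b).re ^ 2 * (c - b) ≤ |W| / (h ξ).re ^ 2 * (c - b) := by gcongr
      _ = |g c - g b| := by rw [← he, abs_mul, abs_div, abs_of_pos hξ0, abs_of_pos hcb]
      _ ≤ |g b| + |g c| := (abs_sub _ _).trans (add_comm _ _).le
  have hab' : |g a| ≤ |g b| + |W| / (h b).re ^ 2 * (b - a) := by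
    rcases hab.eq_or_lt with rfl | hab
    · simp
    obtain ⟨ξ, hξ, he⟩ := exists_hasDerivAt_eq_slope g (fun r => W / (h r).re ^ 2) hab
      (hgc.mono (Icc_subset_Icc_right hbc.le)) fun r hr => hgd r hr.1 (hr.2.le.trans hbc.le)
    have hba : 0 < b - a := sub_pos.2 hab
    rw [eq_div_iff hba.ne'] at he
    have hξb := hleft ξ (Ioo_subset_Icc_self hξ)
    have h1 : |W| / (h ξ).re ^ 2 ≤ |W| / (h b).re ^ 2 :=
      div_le_div_of_nonneg_left (abs_nonneg _) hb2 hξb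
    calc |g a| = |g b - (g b - g a)| := by ring_nf
      _ ≤ |g b| + |g b - g a| := abs_sub _ _
      _ = |g b| + |W| / (h ξ).re ^ 2 * (b - a) := by
        rw [← he, abs_mul (W / _), abs_div W, abs_of_pos (hb2.trans_le hξb), abs_of_pos hba]
      _ ≤ _ := by gcongr
  refine ⟨hne' a ⟨le_rfl, hab.trans hbc.le⟩, hab'.trans ?_⟩
  have hcb : 0 < c - b := sub_pos.2 hbc
  have h1 : |W| / (h b).re ^ 2 ≤ (|g b| + |g c|) / (c - b) := by
    rwa [le_div_iff₀ hcb]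
  have h2 := mul_le_mul_of_nonneg_right h1 (sub_nonneg.2 hab)
  have h3 : (|g b| + |g c|) / (c - b) * (b - a) = (b - a) / (c - b) * (|g b| + |g c|) := by ring
  linarith

/-- Supplies the data of the barrier estimate on `[b, 2b]`: in `G + E` the real growth integral `G`
eventually exceeds `1 + 1/δ`, while `|E| ≤ 1`. -/
theorem eventually_exteriorJost_phase {b δ : ℝ} (hb : 0 < b) (hδ : 0 < δ) :
    ∀ᶠ m : ℝ in atTop, ∀ h : ℝ → ℂ,
      (∀ r, b ≤ r → h r = Complex.exp (-(Complex.I * Real.pi * (m / 2))) *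
        exteriorJost Complex.I m r) →
      (∀ r ∈ Icc b (2 * b), (h r).re ≠ 0) ∧ (h (2 * b)).re ^ 2 < (h b).re ^ 2 ∧
        |(h b).im / (h b).re| ≤ δ ∧ |(h (2 * b)).im / (h (2 * b)).re| ≤ δ := by
  have t2 : Tendsto (fun m : ℝ => (2 : ℝ) ^ m) atTop atTop :=
    tendsto_rpow_atTop_of_base_gt_one 2 (by norm_num)
  have t34 : Tendsto (fun m : ℝ => (3 / 4 : ℝ) ^ m) atTop (𝓝 0) :=
    tendsto_rpow_atTop_of_base_lt_one _ (by norm_num) (by norm_num)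
  filter_upwards [eventually_gt_atTop 0, t34.eventually (gt_mem_nhds (by norm_num : (0 : ℝ) < 1 / 2)),
    t2.eventually_gt_atTop (12 * Real.exp (4 * b)),
    t2.eventually_gt_atTop ((1 + 1 / δ) * Real.exp (8 * b))] with m hm h34 h2a h2b h hh
  obtain ⟨C, hC, hph⟩ := exteriorJost_phase hm
  have hform : ∀ r, b ≤ r → ∃ E : ℂ, ‖E‖ ≤ 1 ∧
      (h r).re = C * r ^ (m + 1) * (growthIntegral m r + E.re) ∧
      (h r).im = C * r ^ (m + 1) * E.im := by
    intro r hr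
    obtain ⟨E, hE, he⟩ := hph r (hb.trans_le hr)
    refine ⟨E, hE, ?_⟩
    have h1 : h r = ((C * r ^ (m + 1) : ℝ) : ℂ) * (growthIntegral m r + E) := by
      rw [hh r hr, he, ← mul_assoc, ← Complex.exp_add, neg_add_cancel, Complex.exp_zero, one_mul]
    rw [h1, Complex.re_ofReal_mul, Complex.im_ofReal_mul]
    simp
  have hgrow : ∀ r ∈ Icc b (2 * b), 1 + 1 / δ < growthIntegral m r := by
    intro r hr
    have h1 := le_growthIntegral hm.le (hb.trans_le hr.1)
    have h3 : (2 : ℝ) ^ m ≤ 10 ^ m := Real.rpow_le_rpow (by norm_num) (by norm_num) hm.le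
    have h4 : Real.exp (-(8 * b)) ≤ Real.exp (-(4 * r)) :=
      Real.exp_le_exp.2 (by linarith [hr.2])
    have h5 : Real.exp (-(8 * b)) * ((1 + 1 / δ) * Real.exp (8 * b)) = 1 + 1 / δ := by
      rw [Real.exp_neg]
      field_simp
    calc 1 + 1 / δ < Real.exp (-(8 * b)) * 2 ^ m := by
          rw [← h5]; exact mul_lt_mul_of_pos_left h2b (Real.exp_pos _)
      _ ≤ Real.exp (-(4 * r)) * 10 ^ m := by gcongr
      _ ≤ _ := h1
  have habs : ∀ E : ℂ, ‖E‖ ≤ 1 → |E.re| ≤ 1 ∧ |E.im| ≤ 1 := fun E hE =>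
    ⟨(Complex.abs_re_le_norm E).trans hE, (Complex.abs_im_le_norm E).trans hE⟩
  have hδ' : 0 < 1 / δ := by positivity
  have hratio : ∀ r ∈ Icc b (2 * b), |(h r).im / (h r).re| ≤ δ := by
    intro r hr
    obtain ⟨E, hE, hre, him⟩ := hform r hr.1
    have hr0 : 0 < r := hb.trans_le hr.1
    have hg := hgrow r hr
    have hE1 := (abs_le.1 (habs E hE).1).1
    have hpos : 0 < C * r ^ (m + 1) := by positivity
    have h1 : 1 / δ < growthIntegral m r + E.re := by linarith
    rw [hre, him, mul_div_mul_left _ _ hpos.ne', abs_div, abs_of_pos (hδ'.trans h1),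
      div_le_iff₀ (hδ'.trans h1)]
    calc |E.im| ≤ 1 := (habs E hE).2
      _ = δ * (1 / δ) := by field_simp
      _ ≤ _ := by gcongr
  refine ⟨fun r hr => ?_, ?_, hratio b ⟨le_rfl, by linarith⟩, hratio (2 * b) ⟨by linarith, le_rfl⟩⟩
  · obtain ⟨E, hE, hre, _⟩ := hform r hr.1
    have hr0 : 0 < r := hb.trans_le hr.1
    have hg := hgrow r hr
    have hE1 := (abs_le.1 (habs E hE).1).1
    rw [hre]
    have : 0 < growthIntegral m r + E.re := by linarith
    positivity
  · obtain ⟨E, hE, hre, _⟩ := hform b le_rfl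
    obtain ⟨E', hE', hre', _⟩ := hform (2 * b) (by linarith)
    have hg := hgrow (2 * b) ⟨by linarith, le_rfl⟩
    have hE1 := (abs_le.1 (habs E hE).1).1
    have hE2 := abs_le.1 (habs E' hE').1
    have hdbl := growthIntegral_two_mul_le hm.le hb
    have hlow := le_growthIntegral hm.le hb
    have h5 : (1 : ℝ) ≤ 5 ^ m := Real.one_le_rpow (by norm_num) hm.le
    have h6 : (9 / 2 : ℝ) ^ m ≤ 5 ^ m := Real.rpow_le_rpow (by norm_num) (by norm_num) hm.le
    have h7 : (2 : ℝ) ^ m ≤ 5 ^ m := Real.rpow_le_rpow (by norm_num) (by norm_num) hm.le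
    have h8 : (10 : ℝ) ^ m = 2 ^ m * 5 ^ m := by
      rw [← Real.mul_rpow (by norm_num) (by norm_num)]; norm_num
    -- The errors are at most `3 * 5^m` from the doubling estimate, `2 * 5^m` from `E'` and `1 ≤
    -- 5^m` from `E`. Their sum `6 * 5^m` must stay below the half of the growth integral left after
    -- `(3/4)^m < 1/2`.
    have h9 : 12 * 5 ^ m < Real.exp (-(4 * b)) * 10 ^ m := by
      rw [h8, ← mul_assoc]
      refine mul_lt_mul_of_pos_right ?_ (by linarith)
      calc (12 : ℝ) = Real.exp (-(4 * b)) * (12 * Real.exp (4 * b)) := by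
            rw [Real.exp_neg]; field_simp
        _ < _ := mul_lt_mul_of_pos_left h2a (Real.exp_pos _)
    have h10 : (2 : ℝ) ^ (m + 1) = 2 * 2 ^ m := by
      rw [Real.rpow_add two_pos, Real.rpow_one, mul_comm]
    have hp0 : 0 < growthIntegral m b := by linarith
    have h11 : (3 / 4 : ℝ) ^ m * growthIntegral m b ≤ 1 / 2 * growthIntegral m b := by gcongr
    have h12 : (2 : ℝ) ^ (m + 1) * (growthIntegral m (2 * b) + E'.re) <
        growthIntegral m b + E.re := by
      have h13 : (2 : ℝ) ^ (m + 1) * E'.re ≤ 2 * 2 ^ m := by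
        rw [h10]; exact mul_le_of_le_one_right (by positivity) hE2.2
      rw [mul_add]
      linarith
    rw [hre, hre', Real.mul_rpow two_pos.le hb.le]
    have h14 : 0 < growthIntegral m (2 * b) + E'.re := by linarith
    refine pow_lt_pow_left₀ ?_ (by positivity) two_ne_zero
    calc C * (2 ^ (m + 1) * b ^ (m + 1)) * (growthIntegral m (2 * b) + E'.re)
        = C * b ^ (m + 1) * (2 ^ (m + 1) * (growthIntegral m (2 * b) + E'.re)) := by ring
      _ < _ := mul_lt_mul_of_pos_left h12 (by positivity)

/-! ### The radial equation -/

/-- The coefficient of the radial equation `u'' = k u`. -/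
noncomputable def radialCoefficient (V : Plane → ℝ) (A : Plane → Plane) (ν : ℂ) (r : ℝ) : ℂ :=
  ((ν - (magneticGamma A r : ℂ)) ^ 2 - 1 / 4) / (r : ℂ) ^ 2 + (radialProfile V r : ℂ) - 1

section Radial

variable {V : Plane → ℝ} {A : Plane → Plane} {r₀ R : ℝ}

/-- The terms containing `γ(R)` cancel in `ν_R² + r² q_ν`, leaving `(ν - γ(r))² + r² V`, so the
coefficient does not depend on `R`. -/
theorem isRadialSolution_iff {ν : ℂ} {u : ℝ → ℂ} :
    IsRadialSolution V A r₀ R ν u ↔ ∃ du, IsSolution (radialCoefficient V A ν) r₀ u du := by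
  have key : ∀ (r : ℝ) (ddu : ℂ),
      - ddu + (((ν - (magneticGamma A R : ℂ)) ^ 2 - 1 / 4) / (r : ℂ) ^ 2 +
        qPotential V A R ν r) * u r = u r ↔ ddu = radialCoefficient V A ν r * u r := by
    intro r ddu
    have h : ((ν - (magneticGamma A R : ℂ)) ^ 2 - 1 / 4) / (r : ℂ) ^ 2 + qPotential V A R ν r =
        radialCoefficient V A ν r + 1 := by
      simp only [qPotential, radialCoefficient]
      ring
    rw [h]
    constructor
    · intro h1; linear_combination -h1
    · intro h1; linear_combination -h1
  constructor
  · rintro ⟨du, h1, h2, S, hS, h3⟩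
    refine ⟨du, h1, h2, S, hS, fun r hr hrS => ?_⟩
    obtain ⟨ddu, h4, h5⟩ := h3 r hr hrS
    rwa [(key r ddu).1 h5] at h4
  · rintro ⟨du, h1, h2, S, hS, h3⟩
    exact ⟨du, h1, h2, S, hS, fun r hr hrS => ⟨_, h3 r hr hrS, (key r _).2 rfl⟩⟩

theorem isJostSolution_iff {ν κ : ℂ} (hκ : κ = Complex.I ∨ κ = -Complex.I) {u : ℝ → ℂ} :
    IsJostSolution V A r₀ R ν κ u ↔ ∃ du, IsJost (radialCoefficient V A ν) r₀ κ u du := by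
  have hnorm := norm_exp_mul_ofReal hκ
  have h : Asymptotics.IsEquivalent atTop u (fun r : ℝ => Complex.exp (κ * (r : ℂ))) ↔
      Tendsto (fun r : ℝ => u r - Complex.exp (κ * r)) atTop (𝓝 0) := by
    rw [Asymptotics.IsEquivalent, ← Asymptotics.isLittleO_norm_right]
    simp only [hnorm]
    exact Asymptotics.isLittleO_one_iff ℝ
  simp only [IsJostSolution, isRadialSolution_iff, h, IsJost, exists_and_right]

theorem radialProfile_eq_zero {f : Plane → ℝ} (hf : tsupport f ⊆ Metric.ball 0 R) {r : ℝ}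
    (hr : R ≤ r) : radialProfile f r = 0 := by
  refine (image_eq_zero_of_notMem_tsupport fun h => ?_ : f !₂[r, 0] = 0)
  have h1 := hf h
  rw [mem_ball_zero_iff, EuclideanSpace.norm_eq] at h1
  simp only [Fin.sum_univ_two] at h1
  simp [Real.sqrt_sq_eq_abs] at h1
  linarith [le_abs_self r]

theorem continuous_radialProfile {f : Plane → ℝ} (hf : Continuous f) :
    Continuous (radialProfile f) := by
  refine hf.comp ((PiLp.continuous_toLp 2 _).comp (continuous_pi fun i => ?_))
  fin_cases i <;> simp <;> fun_prop

theorem Admissible.continuous_integrand (h : Admissible V A) :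
    Continuous fun τ => radialProfile (magneticField A) τ * τ :=
  (continuous_radialProfile h.smooth_B.continuous).mul continuous_id

theorem Admissible.continuous_magneticGamma (h : Admissible V A) : Continuous (magneticGamma A) :=
  intervalIntegral.continuous_primitive
    (fun _ _ => h.continuous_integrand.intervalIntegrable _ _) 0

theorem Admissible.magneticGamma_eq (h : Admissible V A)
    (hB : tsupport (magneticField A) ⊆ Metric.ball 0 R) {r : ℝ} (hr : R ≤ r) :
    magneticGamma A r = magneticGamma A R := by
  have h1 := intervalIntegral.integral_interval_sub_left
    (h.continuous_integrand.intervalIntegrable 0 r (μ := volume))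
    (h.continuous_integrand.intervalIntegrable 0 R)
  have h2 : ∫ τ in R..r, radialProfile (magneticField A) τ * τ = 0 := by
    rw [← intervalIntegral.integral_zero (a := R) (b := r)]
    refine intervalIntegral.integral_congr fun τ hτ => ?_
    rw [uIcc_of_le hr] at hτ
    simp [radialProfile_eq_zero hB hτ.1]
  rw [h2] at h1
  exact sub_eq_zero.1 h1

/-- Continuity, or at exceptional points the two one-sided limits and the point value, gives a bound
near each point; compactness makes it uniform. -/
theorem PiecewiseContinuousOnHalfLine.exists_bound {f : ℝ → ℝ}
    (hf : PiecewiseContinuousOnHalfLine f) {a c : ℝ} (ha : 0 < a) :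
    ∃ M, ∀ r ∈ Icc a c, |f r| ≤ M := by
  obtain ⟨D, hD, hc, hr, hl⟩ := hf
  refine isCompact_Icc.induction_on (p := fun s => ∃ M, ∀ r ∈ s, |f r| ≤ M) ⟨0, by simp⟩
    (fun s t hst ⟨M, hM⟩ => ⟨M, fun r hr => hM r (hst hr)⟩)
    (fun s t ⟨M, hM⟩ ⟨N, hN⟩ => ⟨max M N, fun r hr => hr.elim
      (fun h => (hM r h).trans (le_max_left _ _)) fun h => (hN r h).trans (le_max_right _ _)⟩) ?_
  intro x hx
  have hx0 : 0 < x := ha.trans_le hx.1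
  suffices h : ∃ M, ∀ᶠ r in 𝓝 x, |f r| ≤ M by
    obtain ⟨M, hM⟩ := h
    exact ⟨_, mem_nhdsWithin_of_mem_nhds hM, M, fun r hr => hr⟩
  by_cases hxD : x ∈ D
  · obtain ⟨y, hy⟩ := hr x hxD hx0.le
    obtain ⟨z, hz⟩ := hl x hxD hx0
    refine ⟨max (|f x|) (max (|y| + 1) (|z| + 1)), ?_⟩
    rw [← nhdsNE_sup_pure, ← nhdsLT_sup_nhdsGT, eventually_sup, eventually_sup]
    refine ⟨⟨?_, ?_⟩, ?_⟩
    · filter_upwards [hz.abs.eventually (gt_mem_nhds (lt_add_one |z|))] with r h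
      exact h.le.trans ((le_max_right _ _).trans (le_max_right _ _))
    · filter_upwards [hy.abs.eventually (gt_mem_nhds (lt_add_one |y|))] with r h
      exact h.le.trans ((le_max_left _ _).trans (le_max_right _ _))
    · exact eventually_pure.2 (le_max_left _ _)
  · have h1 : ContinuousAt f x := (hc x hx0.le hxD).continuousAt (Ici_mem_nhds hx0)
    refine ⟨|f x| + 1, ?_⟩
    filter_upwards [h1.tendsto.abs.eventually (gt_mem_nhds (lt_add_one |f x|))] with r h
    exact h.le

theorem radialCoefficient_eq (h : Admissible V A) (hV : tsupport V ⊆ Metric.ball 0 R)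
    (hB : tsupport (magneticField A) ⊆ Metric.ball 0 R) (ν : ℂ) {r : ℝ} (hr : R ≤ r) :
    radialCoefficient V A ν r =
      ((ν - (magneticGamma A R : ℂ)) ^ 2 - 1 / 4) / (r : ℂ) ^ 2 - 1 := by
  rw [radialCoefficient, h.magneticGamma_eq hB hr, radialProfile_eq_zero hV hr]
  simp

theorem tendsto_radialCoefficient (h : Admissible V A) (hV : tsupport V ⊆ Metric.ball 0 R)
    (hB : tsupport (magneticField A) ⊆ Metric.ball 0 R) (ν : ℂ) :
    Tendsto (radialCoefficient V A ν) atTop (𝓝 (-1)) := by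
  have h1 : Tendsto (fun r : ℝ => ((r ^ 2 : ℝ) : ℂ)⁻¹) atTop (𝓝 0) := by
    have h2 : Tendsto (fun r : ℝ => (r ^ 2)⁻¹) atTop (𝓝 0) :=
      tendsto_inv_atTop_zero.comp (tendsto_pow_atTop two_ne_zero)
    have h3 := (Complex.continuous_ofReal.tendsto 0).comp h2
    simpa [Function.comp_def] using h3
  have h2 := (h1.const_mul ((ν - (magneticGamma A R : ℂ)) ^ 2 - 1 / 4)).sub_const 1
  rw [mul_zero, zero_sub] at h2
  refine h2.congr' ?_
  filter_upwards [eventually_ge_atTop R] with r hr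
  rw [radialCoefficient_eq h hV hB ν hr, div_eq_mul_inv]
  push_cast
  rfl

/-- Jost solutions exist, and outside the support they are given by the Laplace integral. -/
theorem exists_isJost (h : Admissible V A) (hV : tsupport V ⊆ Metric.ball 0 R)
    (hB : tsupport (magneticField A) ⊆ Metric.ball 0 R) (hr₀ : 0 < r₀) {ν κ m : ℂ}
    (hκ : κ = Complex.I ∨ κ = -Complex.I) (hm : -1 < m.re)
    (hmν : m * (m + 1) = (ν - (magneticGamma A R : ℂ)) ^ 2 - 1 / 4) :
    ∃ u du, IsJost (radialCoefficient V A ν) r₀ κ u du ∧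
      EqOn u (exteriorJost κ m) (Ici (max R r₀)) := by
  obtain ⟨dv, hv⟩ := exteriorJost_isJost hκ hm (hr₀.trans_le (le_max_right R r₀))
    (k := radialCoefficient V A ν) fun r hr => by
      rw [radialCoefficient_eq h hV hB ν ((le_max_left _ _).trans hr.le), hmν]
  obtain ⟨M, hM⟩ := h.piecewise_V.exists_bound (c := max R r₀) hr₀
  obtain ⟨D, hD, hcont, -, -⟩ := h.piecewise_V
  have hpos : ∀ r ∈ Icc r₀ (max R r₀), 0 < r := fun r hr => hr₀.trans_le hr.1
  have hγ := h.continuous_magneticGamma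
  have hmain : ContinuousOn (fun r : ℝ => ((ν - (magneticGamma A r : ℂ)) ^ 2 - 1 / 4) /
      (r : ℂ) ^ 2) (Ioi 0) := by
    refine ContinuousOn.div (by fun_prop) (by fun_prop) fun r hr => ?_
    exact pow_ne_zero _ (by exact_mod_cast (ne_of_gt hr))
  obtain ⟨N, hN⟩ := isCompact_Icc.exists_bound_of_continuousOn
    (hmain.mono fun r hr => hpos r hr : ContinuousOn _ (Icc r₀ (max R r₀)))
  have hk : ∀ r ∈ Icc r₀ (max R r₀), r ∉ D → ContinuousAt (radialCoefficient V A ν) r := by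
    intro r hr hrD
    have h1 : ContinuousAt (radialProfile V) r :=
      (hcont r (hpos r hr).le hrD).continuousAt (Ici_mem_nhds (hpos r hr))
    have h2 := hmain.continuousAt (Ioi_mem_nhds (hpos r hr))
    exact (h2.add (Complex.continuous_ofReal.continuousAt.comp h1)).sub continuousAt_const
  have hK : ∀ r ∈ Icc r₀ (max R r₀), ‖radialCoefficient V A ν r‖ ≤ N + M + 1 := by
    intro r hr
    refine (norm_sub_le _ _).trans ?_
    rw [norm_one]
    refine add_le_add_left ((norm_add_le _ _).trans (add_le_add (hN r hr) ?_)) _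
    rw [Complex.norm_real]
    exact hM r hr
  obtain ⟨w, dw, hw, hwv⟩ := hv.1.exists_extension (le_max_right R r₀) hD hk hK
  refine ⟨w, dw, ⟨hw, hv.2.congr' ?_⟩, hwv⟩
  filter_upwards [eventually_ge_atTop (max R r₀)] with r hr
  rw [hwv hr]

end Radial

/-! ### Jost functions, their phase at large real order, and the limits of the Regge function -/

section Main

variable {V : Plane → ℝ} {A : Plane → Plane} {r₀ R : ℝ}

/-- Both `m = ±w - 1/2` solve the equation; the sign is chosen so that `Re m ≥ -1/2`, which makes
the Laplace integral converge at `0`. -/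
theorem exists_exponent (w : ℂ) : ∃ m : ℂ, -1 < m.re ∧ m * (m + 1) = w ^ 2 - 1 / 4 := by
  rcases le_total 0 w.re with h | h
  · refine ⟨w - 1 / 2, ?_, by ring⟩
    have : (w - 1 / 2).re = w.re - 1 / 2 := by simp
    rw [this]; linarith
  · refine ⟨-w - 1 / 2, ?_, by ring⟩
    have : (-w - 1 / 2).re = -w.re - 1 / 2 := by simp
    rw [this]; linarith

/-- The Jost solution exists, is unique, and is explicit outside the support. -/
theorem jostSolution_spec (h : Admissible V A) (hV : tsupport V ⊆ Metric.ball 0 R)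
    (hB : tsupport (magneticField A) ⊆ Metric.ball 0 R) (hr₀ : 0 < r₀) (ν : ℂ) {κ : ℂ}
    (hκ : κ = Complex.I ∨ κ = -Complex.I) :
    IsJostSolution V A r₀ R ν κ (jostSolution V A r₀ R ν κ) ∧
      ∀ u : ℝ → ℂ, IsJostSolution V A r₀ R ν κ u →
        EqOn u (jostSolution V A r₀ R ν κ) (Ici r₀) := by
  have hκ' : -κ = Complex.I ∨ -κ = -Complex.I := by
    rcases hκ with rfl | rfl <;> simp
  obtain ⟨m, hm, hmν⟩ := exists_exponent (ν - (magneticGamma A R : ℂ))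
  have hex : ∃ u, IsJostSolution V A r₀ R ν κ u := by
    obtain ⟨u, du, hu, -⟩ := exists_isJost h hV hB hr₀ hκ hm hmν
    exact ⟨u, (isJostSolution_iff hκ).2 ⟨du, hu⟩⟩
  have hspec : IsJostSolution V A r₀ R ν κ (jostSolution V A r₀ R ν κ) := by
    rw [jostSolution, dif_pos hex]
    exact hex.choose_spec
  refine ⟨hspec, fun u hu => ?_⟩
  obtain ⟨v, dv, hv, -⟩ := exists_isJost h hV hB hr₀ hκ' hm hmν
  obtain ⟨du, hdu⟩ := (isJostSolution_iff hκ).1 hu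
  obtain ⟨dw, hdw⟩ := (isJostSolution_iff hκ).1 hspec
  exact hdu.eqOn (tendsto_radialCoefficient h hV hB ν) hκ hdw hv

theorem radialCoefficient_ofReal (ν r : ℝ) :
    radialCoefficient V A ν r =
      ((((ν - magneticGamma A r) ^ 2 - 1 / 4) / r ^ 2 + radialProfile V r - 1 : ℝ) : ℂ) := by
  simp [radialCoefficient]

theorem jostMinus_eq_conj (h : Admissible V A) (hV : tsupport V ⊆ Metric.ball 0 R)
    (hB : tsupport (magneticField A) ⊆ Metric.ball 0 R) (hr₀ : 0 < r₀) (ν : ℝ) :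
    jostMinus V A r₀ R r₀ ν = starRingEnd ℂ (jostPlus V A r₀ R r₀ ν) := by
  obtain ⟨du, hu⟩ := (isJostSolution_iff (Or.inl rfl)).1
    (jostSolution_spec h hV hB hr₀ (ν : ℂ) (Or.inl rfl)).1
  have hc := hu.conj (Or.inl rfl) fun r _ => by
    rw [radialCoefficient_ofReal]; exact Complex.ofReal_im _
  exact ((jostSolution_spec h hV hB hr₀ (ν : ℂ) (Or.inr rfl)).2 _
    ((isJostSolution_iff (Or.inr rfl)).2 ⟨_, hc⟩) self_mem_Ici).symm

/-- At a zero of `F⁺` its conjugate `F⁻` would vanish too, contradicting that their Wronskian is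
`-2i`. -/
theorem jostPlus_ne_zero (h : Admissible V A) (hV : tsupport V ⊆ Metric.ball 0 R)
    (hB : tsupport (magneticField A) ⊆ Metric.ball 0 R) (hr₀ : 0 < r₀) (ν : ℝ) :
    jostPlus V A r₀ R r₀ ν ≠ 0 := by
  intro h0
  have hm0 := jostMinus_eq_conj h hV hB hr₀ ν
  rw [h0, map_zero] at hm0
  obtain ⟨du, hu⟩ := (isJostSolution_iff (Or.inl rfl)).1
    (jostSolution_spec h hV hB hr₀ (ν : ℂ) (Or.inl rfl)).1
  obtain ⟨dv, hv⟩ := (isJostSolution_iff (Or.inr rfl)).1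
    (jostSolution_spec h hV hB hr₀ (ν : ℂ) (Or.inr rfl)).1
  have hw := hu.wronskian_eq (tendsto_radialCoefficient h hV hB ν) (Or.inl rfl) (Or.inr rfl) hv
    (le_refl r₀)
  unfold jostPlus at h0
  unfold jostMinus at hm0
  rw [h0, hm0] at hw
  have h1 := congrArg Complex.im hw
  norm_num at h1

theorem regge_eq (ν : ℝ) (V : Plane → ℝ) (A : Plane → Plane) (r₀ R : ℝ) :
    regge V A r₀ R ν = -(Complex.exp (Complex.I * Real.pi * (ν + 1 / 2)) *
      (jostMinus V A r₀ R r₀ ν / jostPlus V A r₀ R r₀ ν)) := by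
  rw [regge, jostAlpha, jostBeta, neg_mul, div_neg, mul_div_mul_left _ _ Complex.I_ne_zero, mul_neg]

theorem norm_regge (h : Admissible V A) (hV : tsupport V ⊆ Metric.ball 0 R)
    (hB : tsupport (magneticField A) ⊆ Metric.ball 0 R) (hr₀ : 0 < r₀) (ν : ℝ) :
    ‖regge V A r₀ R ν‖ = 1 := by
  have h1 : ‖jostPlus V A r₀ R r₀ ν‖ ≠ 0 := norm_ne_zero_iff.2 (jostPlus_ne_zero h hV hB hr₀ ν)
  rw [regge_eq, jostMinus_eq_conj h hV hB hr₀, norm_neg, norm_mul, norm_div, Complex.norm_conj,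
    div_self h1, mul_one, Complex.norm_exp]
  simp

theorem norm_conj_div_sub_one_le {z : ℂ} (hz : z.re ≠ 0) :
    ‖starRingEnd ℂ z / z - 1‖ ≤ 2 * |z.im / z.re| := by
  have hz0 : z ≠ 0 := fun h => hz (by simp [h])
  have h1 : starRingEnd ℂ z / z - 1 = -(2 * z.im * Complex.I) / z := by
    rw [div_sub_one hz0]
    congr 1
    apply Complex.ext <;> simp
    ring
  have h2 : 0 < |z.re| := abs_pos.2 hz
  rw [h1, norm_div, norm_neg, abs_div]
  simp only [norm_mul, Complex.norm_I, mul_one, Complex.norm_real, Real.norm_eq_abs]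
  rw [show ‖(2 : ℂ)‖ = 2 by norm_num, mul_div_assoc]
  exact mul_le_mul_of_nonneg_left
    (div_le_div_of_nonneg_left (abs_nonneg _) h2 (Complex.abs_re_le_norm z)) zero_le_two

/-- For large orders the radial coefficient is nonnegative on a given compact interval. -/
theorem eventually_radialCoefficient_nonneg (h : Admissible V A) (hr₀ : 0 < r₀) (c : ℝ) :
    ∀ᶠ m : ℝ in atTop, ∀ ν : ℝ, |ν - magneticGamma A R| - 1 / 2 = m →
      ∀ r ∈ Ioo r₀ c, 0 ≤ (radialCoefficient V A ν r).re := by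
  obtain ⟨M, hM⟩ := h.piecewise_V.exists_bound (c := c) hr₀
  obtain ⟨G, hG⟩ := isCompact_Icc.exists_bound_of_continuousOn
    (h.continuous_magneticGamma.continuousOn (s := Icc r₀ c))
  filter_upwards [eventually_ge_atTop (|magneticGamma A R| + G + (1 + (1 + |M|) * c ^ 2))]
    with m hm ν hν r hr
  have hr' := Ioo_subset_Icc_self hr
  have hr0 : 0 < r := hr₀.trans hr.1
  have h1 : |ν - magneticGamma A R| ≤ |ν - magneticGamma A r| + (G + |magneticGamma A R|) := by
    have e : ν - magneticGamma A R =
        (ν - magneticGamma A r) + (magneticGamma A r - magneticGamma A R) := by ring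
    rw [e]
    refine (abs_add_le _ _).trans (add_le_add_right ((abs_sub _ _).trans ?_) _)
    exact add_le_add_left (hG r hr') _
  -- A number at least `1` is below its square, so the centrifugal term is at least `1 + |M|` on the
  -- interval and dominates `V - 1`.
  have hT : 1 + (1 + |M|) * c ^ 2 ≤ |ν - magneticGamma A r| := by linarith
  have hT0 : 0 ≤ (1 + |M|) * c ^ 2 := by positivity
  have h2 : 1 + (1 + |M|) * c ^ 2 ≤ (ν - magneticGamma A r) ^ 2 := by
    rw [← sq_abs (ν - magneticGamma A r)]
    nlinarith
  have h3 : (1 + |M|) * r ^ 2 ≤ (1 + |M|) * c ^ 2 := by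
    have := hr.2.le
    gcongr
  have h4 : 1 + |M| ≤ ((ν - magneticGamma A r) ^ 2 - 1 / 4) / r ^ 2 := by
    rw [le_div_iff₀ (by positivity)]
    linarith
  rw [radialCoefficient_ofReal, Complex.ofReal_re]
  have h5 := (abs_le.1 ((hM r hr').trans (le_abs_self M))).1
  linarith

/-- The phase of the Jost function as the order tends to infinity. -/
theorem eventually_jost_phase (h : Admissible V A) (hV : tsupport V ⊆ Metric.ball 0 R)
    (hB : tsupport (magneticField A) ⊆ Metric.ball 0 R) (hr₀ : 0 < r₀) {δ : ℝ} (hδ : 0 < δ) :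
    ∀ᶠ m : ℝ in atTop, ∀ ν : ℝ, |ν - magneticGamma A R| - 1 / 2 = m →
      ‖jostMinus V A r₀ R r₀ ν / jostPlus V A r₀ R r₀ ν *
        Complex.exp (Complex.I * Real.pi * m) - 1‖ ≤ 6 * δ := by
  set b := max R r₀
  have hb0 : 0 < b := hr₀.trans_le (le_max_right _ _)
  have hrb : r₀ ≤ b := le_max_right _ _
  filter_upwards [eventually_exteriorJost_phase hb0 hδ, eventually_gt_atTop 0,
    eventually_radialCoefficient_nonneg (V := V) (R := R) h hr₀ (2 * b)] with m hph hm hk ν hν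
  have hmν : (m : ℂ) * (m + 1) = ((ν : ℂ) - (magneticGamma A R : ℂ)) ^ 2 - 1 / 4 := by
    have h1 : m * (m + 1) = (ν - magneticGamma A R) ^ 2 - 1 / 4 := by
      rw [← hν, ← sq_abs (ν - magneticGamma A R)]; ring
    have h2 := congrArg (fun x : ℝ => (x : ℂ)) h1
    push_cast at h2
    exact h2
  obtain ⟨u, du, hu, hue⟩ := exists_isJost h hV hB hr₀ (Or.inl rfl)
    (by rw [Complex.ofReal_re]; linarith) hmν
  have hF : u r₀ = jostPlus V A r₀ R r₀ ν :=
    (jostSolution_spec h hV hB hr₀ (ν : ℂ) (Or.inl rfl)).2 u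
      ((isJostSolution_iff (Or.inl rfl)).2 ⟨du, hu⟩) self_mem_Ici
  -- The rotation by `e` makes the solution almost real beyond the support; its conjugate quotient
  -- produces the factor `e^{iπm}` of the statement.
  set e : ℂ := Complex.exp (-(Complex.I * Real.pi * (m / 2))) with he
  have he0 : e ≠ 0 := Complex.exp_ne_zero _
  obtain ⟨hne, hlt, hδ1, hδ2⟩ := hph (fun r => e * u r) fun r hr => by
    simp only [hue hr, he]
  obtain ⟨hz, hle⟩ := (hu.1.const_mul e).abs_im_div_re_le hrb (by linarith : b < 2 * b)
    (fun r _ => by rw [radialCoefficient_ofReal]; exact Complex.ofReal_im _) (hk ν hν) hne hlt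
  have hfrac : (b - r₀) / (2 * b - b) ≤ 1 := by
    rw [div_le_one (by linarith)]; linarith
  have hquot : jostMinus V A r₀ R r₀ ν / jostPlus V A r₀ R r₀ ν *
      Complex.exp (Complex.I * Real.pi * m) = starRingEnd ℂ (e * u r₀) / (e * u r₀) := by
    have hee : starRingEnd ℂ e = e * Complex.exp (Complex.I * Real.pi * m) := by
      rw [he, ← Complex.exp_conj, ← Complex.exp_add]
      congr 1
      simp only [map_neg, map_mul, map_div₀, Complex.conj_I, Complex.conj_ofReal, Complex.conj_ofNat]
      ring
    have hu0 : u r₀ ≠ 0 := hF ▸ jostPlus_ne_zero h hV hB hr₀ ν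
    rw [jostMinus_eq_conj h hV hB hr₀, ← hF, map_mul, hee]
    field_simp
  rw [hquot]
  refine (norm_conj_div_sub_one_le hz).trans ?_
  have h2 := mul_le_mul hfrac (add_le_add hδ1 hδ2) (by positivity) zero_le_one
  -- The quotient at `r₀` is at most `δ + 1 * (δ + δ) = 3δ`, and passing to `conj z / z - 1` doubles
  -- it.
  linarith

/-- Only `|ν - γ(R)|` enters the phase, so an arbitrary filter along which it tends to infinity
covers both ends of the real line. -/
theorem tendsto_jost_quotient (h : Admissible V A) (hV : tsupport V ⊆ Metric.ball 0 R)
    (hB : tsupport (magneticField A) ⊆ Metric.ball 0 R) (hr₀ : 0 < r₀) {l : Filter ℝ}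
    (hl : Tendsto (fun ν => |ν - magneticGamma A R|) l atTop) :
    Tendsto (fun ν : ℝ => jostMinus V A r₀ R r₀ ν / jostPlus V A r₀ R r₀ ν *
      Complex.exp (Complex.I * Real.pi * ((|ν - magneticGamma A R| - 1 / 2 : ℝ) : ℂ))) l
      (𝓝 1) := by
  rw [Metric.tendsto_nhds]
  intro ε hε
  have h1 := (tendsto_atTop_add_const_right l (-(1 / 2) : ℝ) hl).eventually
    (eventually_jost_phase h hV hB hr₀ (δ := ε / 12) (by positivity))
  filter_upwards [h1] with ν hν
  rw [dist_eq_norm]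
  exact (hν ν (sub_eq_add_neg _ _)).trans_lt (by linarith)

theorem tendsto_regge_atTop (h : Admissible V A) (hV : tsupport V ⊆ Metric.ball 0 R)
    (hB : tsupport (magneticField A) ⊆ Metric.ball 0 R) (hr₀ : 0 < r₀) :
    Tendsto (fun ν : ℝ => regge V A r₀ R ν) atTop
      (𝓝 (Complex.exp (Complex.I * Real.pi * magneticGamma A R))) := by
  have h1 : Tendsto (fun ν => |ν - magneticGamma A R|) atTop atTop :=
    tendsto_abs_atTop_atTop.comp (tendsto_atTop_add_const_right _ _ tendsto_id)
  have h2 := (tendsto_jost_quotient h hV hB hr₀ h1).const_mul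
    (Complex.exp (Complex.I * Real.pi * magneticGamma A R))
  rw [mul_one] at h2
  refine h2.congr' ?_
  filter_upwards [eventually_ge_atTop (magneticGamma A R)] with ν hν
  -- The phases add up to `e^{iπ(ν - 1/2)} = -e^{iπ(ν + 1/2)}`, whose sign is the one in `regge_eq`.
  have h3 : Complex.exp (Complex.I * Real.pi * magneticGamma A R) *
      Complex.exp (Complex.I * Real.pi * ((ν - magneticGamma A R - 1 / 2 : ℝ) : ℂ)) =
      -Complex.exp (Complex.I * Real.pi * (ν + 1 / 2)) := by
    rw [← Complex.exp_add, ← Complex.exp_sub_pi_mul_I]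
    congr 1
    push_cast
    ring
  rw [regge_eq, abs_of_nonneg (sub_nonneg.2 hν)]
  linear_combination (jostMinus V A r₀ R r₀ ν / jostPlus V A r₀ R r₀ ν) * h3

/-- Here `|ν_R| = -ν_R`, so the two phases in `σ` no longer cancel and `σ` behaves like `e^{2πiν}
e^{-iπγ(R)}`. Along the reals it oscillates; the compensating factor is `1` at integers. -/
theorem tendsto_regge_atBot (h : Admissible V A) (hV : tsupport V ⊆ Metric.ball 0 R)
    (hB : tsupport (magneticField A) ⊆ Metric.ball 0 R) (hr₀ : 0 < r₀) :
    Tendsto (fun ν : ℝ => Complex.exp (-(2 * Real.pi * Complex.I * ν)) * regge V A r₀ R ν) atBot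
      (𝓝 (Complex.exp (-(Complex.I * Real.pi * magneticGamma A R)))) := by
  have h1 : Tendsto (fun ν => |ν - magneticGamma A R|) atBot atTop :=
    tendsto_abs_atBot_atTop.comp (tendsto_atBot_add_const_right _ _ tendsto_id)
  have h2 := (tendsto_jost_quotient h hV hB hr₀ h1).const_mul
    (Complex.exp (-(Complex.I * Real.pi * magneticGamma A R)))
  rw [mul_one] at h2
  refine h2.congr' ?_
  filter_upwards [eventually_le_atBot (magneticGamma A R)] with ν hν
  have h3 : Complex.exp (-(Complex.I * Real.pi * magneticGamma A R)) *
      Complex.exp (Complex.I * Real.pi * ((-(ν - magneticGamma A R) - 1 / 2 : ℝ) : ℂ)) =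
      -(Complex.exp (-(2 * Real.pi * Complex.I * ν)) *
        Complex.exp (Complex.I * Real.pi * (ν + 1 / 2))) := by
    rw [← Complex.exp_add, ← Complex.exp_add, ← Complex.exp_sub_pi_mul_I]
    congr 1
    push_cast
    ring
  rw [regge_eq, abs_of_nonpos (sub_nonpos.2 hν)]
  linear_combination (jostMinus V A r₀ R r₀ ν / jostPlus V A r₀ R r₀ ν) * h3

end Main

end MagneticScattering

theorem mainTheorem4
    (V : MagneticScattering.Plane → ℝ)
    (A : MagneticScattering.Plane → MagneticScattering.Plane)
    (hVA : MagneticScattering.Admissible V A)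
    (r₀ : ℝ) (hr₀ : 0 < r₀) (R : ℝ) (hR : 0 < R)
    (hV : tsupport V ⊆ Metric.ball 0 R)
    (hB : tsupport (MagneticScattering.magneticField A) ⊆ Metric.ball 0 R) :
    -- the Jost solutions exist and are unique
    (∀ ν κ : ℂ, κ = Complex.I ∨ κ = -Complex.I →
      MagneticScattering.IsJostSolution V A r₀ R ν κ
        (MagneticScattering.jostSolution V A r₀ R ν κ) ∧
      ∀ u : ℝ → ℂ, MagneticScattering.IsJostSolution V A r₀ R ν κ u →
        Set.EqOn u (MagneticScattering.jostSolution V A r₀ R ν κ) (Set.Ici r₀)) ∧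
    -- on the real line the Regge function is well defined and of modulus one
    (∀ ν : ℝ, MagneticScattering.jostBeta V A r₀ R (ν : ℂ) ≠ 0 ∧
      ‖MagneticScattering.regge V A r₀ R (ν : ℂ)‖ = 1) ∧
    -- the limit of the Regge function along the reals
    Filter.Tendsto (fun ν : ℝ => MagneticScattering.regge V A r₀ R (ν : ℂ)) Filter.atTop
      (nhds (Complex.exp
        (Complex.I * (Real.pi : ℂ) * (MagneticScattering.magneticGamma A R : ℂ)))) ∧
    -- the accumulation of the eigenvalues of the scattering matrix
    (∀ δ : ℤ → ℝ,
      (∀ l : ℤ, Complex.exp (2 * Complex.I * (δ l : ℂ)) =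
        MagneticScattering.regge V A r₀ R (l : ℂ)) →
      Filter.Tendsto (fun l : ℤ => Complex.exp (2 * Complex.I * (δ l : ℂ))) Filter.atTop
        (nhds (Complex.exp
          (Complex.I * (Real.pi : ℂ) * (MagneticScattering.magneticGamma A R : ℂ)))) ∧
      Filter.Tendsto (fun l : ℤ => Complex.exp (2 * Complex.I * (δ l : ℂ))) Filter.atBot
        (nhds (Complex.exp
          (-(Complex.I * (Real.pi : ℂ) * (MagneticScattering.magneticGamma A R : ℂ)))))) := by

  refine ⟨fun ν κ hκ => MagneticScattering.jostSolution_spec hVA hV hB hr₀ ν hκ, fun ν => ⟨?_, ?_⟩,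
    MagneticScattering.tendsto_regge_atTop hVA hV hB hr₀, fun δ hδ => ?_⟩
  · exact mul_ne_zero (neg_ne_zero.2 Complex.I_ne_zero)
      (MagneticScattering.jostPlus_ne_zero hVA hV hB hr₀ ν)
  · exact MagneticScattering.norm_regge hVA hV hB hr₀ ν
  simp only [hδ]
  constructor
  · refine ((MagneticScattering.tendsto_regge_atTop hVA hV hB hr₀).comp
      tendsto_intCast_atTop_atTop).congr fun l => ?_
    simp
  · refine ((MagneticScattering.tendsto_regge_atBot hVA hV hB hr₀).comp
      (tendsto_intCast_atBot_iff.2 tendsto_id)).congr fun l => ?_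
    have h1 : Complex.exp (-(2 * Real.pi * Complex.I * ((l : ℝ) : ℂ))) = 1 :=
      Complex.exp_eq_one_iff.2 ⟨-l, by push_cast; ring⟩
    simp only [Function.comp_apply, id]
    rw [h1, one_mul, Complex.ofReal_intCast]
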